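/- Let $H$ be a Hopf $*$-algebra over $\mathbb{C}$, that is, a complex Hopf algebra $(H,\Delta)$ with an antilinear, antimultiplicative involution $*$ such that $\Delta(h^*)=\Delta(h)^{*\otimes *}$ for all $h\in H$. Let $\varphi:H\to\mathbb{C}$ be a positive invariant integral: $\varphi$ is linear, $\varphi(1)=1$, $(\mathrm{id}\otimes\varphi)\Delta(h)=\varphi(h)1$ and $\varphi(h^*h)\ge 0$ for all $h\in H$. Let $A$ be a unital $*$-algebra over $\mathbb{C}$ with a $*$-preserving coaction $\alpha:A\to A\otimes H$ (a homomorphism of unital $*$-algebras that makes $A$ a right $H$-comodule) which is homogeneous, that is, $\{a\in A\mid \alpha(a)=a\otimes 1\}=\mathbb{C}1_A$. Let $\varphi_A:A\to\mathbb{C}$ be the linear functional determined by $\varphi_A(a)1_A=(\mathrm{id}\otimes\varphi)\alpha(a)$ for $a\in A$, and assume that $\varphi_A$ is positive and faithful: $\varphi_A(a^*a)\ge 0$ for all $a\in A$, and $\varphi_A(a^*a)=0$ only for $a=0$. Then $(A,\alpha)$ is equivariantly absolutely semisimple in the following sense. An $H$-equivariant $A$-module is a complex vector space $V$ with an $A$-module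 structure and a right $H$-comodule structure $\delta:V\to V\otimes H$ such that $\delta(av)=\alpha(a)\delta(v)$ for $a\in A$, $v\in V$; it is unital if $V=AV$. It is equivariantly simple if $AV\ne 0$ and $0$ and $V$ are its only subspaces that are both $A$-submodules and $H$-subcomodules. It is equivariantly absolutely simple if, for every field extension $K$ of $\mathbb{C}$, the $(K\otimes H)$-equivariant $(K\otimes A)$-module $K\otimes V$ (all tensor products over $\mathbb{C}$) is equivariantly simple over the ground field $K$. The assertion is that every unital $H$-equivariant $A$-module is a (possibly empty, possibly infinite) direct sum of equivariantly absolutely simple $H$-equivariant $A$-modules. -/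

import Mathlib

open scoped TensorProduct ComplexOrder

universe uk uH uA uV w

namespace HopfCoaction

section Comodules

variable {k : Type uk} [Field k] {H : Type uH} [Ring H] [HopfAlgebra k H]
variable {V : Type uV} [AddCommGroup V] [Module k V]

/-- `δ : V → V ⊗ H` is a right comodule structure on `V`: it is coassociative and counital. -/
structure IsComodule (δ : V →ₗ[k] V ⊗[k] H) : Prop where
  coassoc : ∀ v : V, TensorProduct.assoc k V H H (δ.rTensor H (δ v)) =
    (Coalgebra.comul (R := k) (A := H)).lTensor V (δ v)
  counit : ∀ v : V,
    TensorProduct.rid k V ((Coalgebra.counit (R := k) (A := H)).lTensor V (δ v)) = v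

/-- `φ` is a (left) invariant integral on `H`: `(id ⊗ φ) Δ(h) = φ(h) 1` and `φ(1) = 1`. -/
structure IsInvariantIntegral (φ : H →ₗ[k] k) : Prop where
  invariant : ∀ h : H,
    TensorProduct.rid k H (φ.lTensor H (Coalgebra.comul (R := k) h)) = φ h • (1 : H)
  normalized : φ 1 = 1

end Comodules

section EquivariantModules

variable {k : Type uk} [Field k] {H : Type uH} [Ring H] [HopfAlgebra k H]
variable {A : Type uA} [Ring A] [Algebra k A]
variable {V : Type uV} [AddCommGroup V] [Module k V]

/-- The algebra of coinvariants `{a | α a = a ⊗ 1}`. -/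
noncomputable def coinvariants (α : A →ₐ[k] A ⊗[k] H) : Subalgebra k A :=
  AlgHom.equalizer α Algebra.TensorProduct.includeLeft

/-- A coaction on a unital algebra is homogeneous if its coinvariants are the scalars `k 1`. -/
def IsHomogeneous (α : A →ₐ[k] A ⊗[k] H) : Prop :=
  coinvariants α = ⊥

/-- The action of `A ⊗ H` on `V ⊗ H` obtained from an action `ρ` of `A` on `V` and left
multiplication of `H`: `(a ⊗ h) (v ⊗ g) = ρ a v ⊗ h g`. -/
noncomputable def tensorAction (H : Type uH) [Ring H] [HopfAlgebra k H]
    (ρ : A →ₐ[k] Module.End k V) :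
    A ⊗[k] H →ₗ[k] V ⊗[k] H →ₗ[k] V ⊗[k] H :=
  TensorProduct.map₂ ρ.toLinearMap (LinearMap.mul k H)

/-- A unital `H`-equivariant `A`-module for the coaction `α`: a vector space `V` with a unital
`A`-module structure `ρ` and an `H`-comodule structure `δ` such that `δ (a v) = α(a) δ(v)`. Since
`A` is unital, `V = A V` holds exactly when `1` acts as the identity, which is part of `ρ` being a
homomorphism of unital algebras. -/
structure IsEquivariantModule (α : A →ₐ[k] A ⊗[k] H) (ρ : A →ₐ[k] Module.End k V)
    (δ : V →ₗ[k] V ⊗[k] H) : Prop where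
  comodule : IsComodule δ
  compat : ∀ (a : A) (v : V), δ (ρ a v) = tensorAction H ρ (α a) (δ v)

/-- A subspace that is both an `A`-submodule and an `H`-subcomodule. -/
structure IsEquivariantSubmodule (ρ : A →ₐ[k] Module.End k V) (δ : V →ₗ[k] V ⊗[k] H)
    (W : Submodule k V) : Prop where
  action_mem : ∀ (a : A), ∀ v ∈ W, ρ a v ∈ W
  coaction_mem : ∀ v ∈ W, δ v ∈ LinearMap.range (W.subtype.rTensor H)

/-- `V` is equivariantly simple: `A V ≠ 0`, and `0` and `V` are the only equivariant submodules. -/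
structure IsEquivariantlySimple (ρ : A →ₐ[k] Module.End k V) (δ : V →ₗ[k] V ⊗[k] H) :
    Prop where
  action_ne_zero : ∃ (a : A) (v : V), ρ a v ≠ 0
  eq_bot_or_eq_top : ∀ W : Submodule k V, IsEquivariantSubmodule ρ δ W → W = ⊥ ∨ W = ⊤

/-- The action of `K ⊗ A` on `K ⊗ V`, `(x ⊗ a) (y ⊗ v) = x y ⊗ a v`. -/
noncomputable def actionBaseChange (K : Type w) [Field K] [Algebra k K]
    (ρ : A →ₐ[k] Module.End k V) : K ⊗[k] A →ₐ[K] Module.End K (K ⊗[k] V) :=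
  AlgHom.liftEquiv k K A (Module.End K (K ⊗[k] V)) ((Module.End.baseChangeHom k K V).comp ρ)

/-- The coaction of `K ⊗ H` on `K ⊗ V`: for `δ v = v₀ ⊗ v₁` it sends `x ⊗ v` to
`(x ⊗ v₀) ⊗ (1 ⊗ v₁)`. -/
noncomputable def coactionBaseChange (K : Type w) [Field K] [Algebra k K]
    (δ : V →ₗ[k] V ⊗[k] H) : K ⊗[k] V →ₗ[K] (K ⊗[k] V) ⊗[K] (K ⊗[k] H) :=
  (TensorProduct.AlgebraTensorModule.distribBaseChange k K V H).toLinearMap ∘ₗ δ.baseChange K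

theorem actionBaseChange_tmul (K : Type w) [Field K] [Algebra k K]
    (ρ : A →ₐ[k] Module.End k V) (x y : K) (a : A) (v : V) :
    actionBaseChange K ρ (x ⊗ₜ[k] a) (y ⊗ₜ[k] v) = (x * y) ⊗ₜ[k] ρ a v := by
  change x • (LinearMap.baseChange K (ρ a)) (y ⊗ₜ[k] v) = _
  simp [TensorProduct.smul_tmul']

theorem coactionBaseChange_tmul (K : Type w) [Field K] [Algebra k K]
    (δ : V →ₗ[k] V ⊗[k] H) (x : K) (v : V) (t : V ⊗[k] H) (ht : δ v = t) :
    coactionBaseChange K δ (x ⊗ₜ[k] v) =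
      TensorProduct.AlgebraTensorModule.distribBaseChange k K V H (x ⊗ₜ[k] t) := by
  simp [coactionBaseChange, ht]

/-- `V` is equivariantly absolutely simple: `K ⊗ V` is simple as a `K ⊗ H`-equivariant
`K ⊗ A`-module for all field extensions `K` of `k` (in an arbitrary universe `w`). -/
def IsEquivariantlyAbsolutelySimple (ρ : A →ₐ[k] Module.End k V) (δ : V →ₗ[k] V ⊗[k] H) :
    Prop :=
  ∀ (K : Type w) [Field K] [Algebra k K],
    IsEquivariantlySimple (actionBaseChange K ρ) (coactionBaseChange K δ)

/-- `(ρ', δ')` is the restriction of the action `ρ` and of the coaction `δ` to the subspace `W`. -/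
structure IsRestriction (ρ : A →ₐ[k] Module.End k V) (δ : V →ₗ[k] V ⊗[k] H) (W : Submodule k V)
    (ρ' : A →ₐ[k] Module.End k W) (δ' : W →ₗ[k] W ⊗[k] H) : Prop where
  action : ∀ (a : A) (v : W), ((ρ' a v : W) : V) = ρ a v
  coaction : ∀ v : W, W.subtype.rTensor H (δ' v) = δ v

open Classical in
/-- `V` is equivariantly absolutely semisimple: it is the direct sum of a (possibly empty, possibly
infinite) family of equivariant submodules each of which is equivariantly absolutely simple. -/
def IsEquivariantlyAbsolutelySemisimple (ρ : A →ₐ[k] Module.End k V)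
    (δ : V →ₗ[k] V ⊗[k] H) : Prop :=
  ∃ (ι : Type uV) (W : ι → Submodule k V), DirectSum.IsInternal W ∧
    ∀ i, ∃ (ρ' : A →ₐ[k] Module.End k (W i)) (δ' : W i →ₗ[k] W i ⊗[k] H),
      IsRestriction ρ δ (W i) ρ' δ' ∧ IsEquivariantlyAbsolutelySimple.{uk, uH, uA, uV, w} ρ' δ'

/-- The coaction `α` is equivariantly absolutely semisimple: every unital `H`-equivariant
`A`-module (in the universe `uV`) is equivariantly absolutely semisimple. -/
def IsCoactionAbsolutelySemisimple (α : A →ₐ[k] A ⊗[k] H) : Prop :=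
  ∀ (V : Type uV) [AddCommGroup V] [Module k V] (ρ : A →ₐ[k] Module.End k V)
    (δ : V →ₗ[k] V ⊗[k] H), IsEquivariantModule α ρ δ →
      IsEquivariantlyAbsolutelySemisimple.{uk, uH, uA, uV, w} ρ δ

end EquivariantModules

end HopfCoaction

/-! An equivariant module is treated as a module over the free algebra on `A ⊕ (H →ₗ[k] k)`:
elements of `A` act by `ρ`, and a functional `f` acts by `v ↦ v₀ f(v₁)`. Submodules are then exactly
the equivariant submodules, so ordinary semisimple module theory applies.

The coaction embeds `V` into the cofree module `V ⊗ H`, which is a sum of images of `A ⊗ H` under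
the maps `a ⊗ h ↦ a v ⊗ h`. Hence it suffices that `A ⊗ H` is semisimple. It carries the form `(φA ⊗
φ)(x* y)`, definite because a positive invariant integral is faithful, and every operator has an
adjoint (`exists_adjoint`). In infinite dimension this does not yet give complements. They exist
because each vector is fixed by some `id ⊗ φ(b ·)`, which has finite rank on cyclic submodules
(`isSemisimpleModule_of_adjoint_of_cyclic`, `exists_finite_orbit`).

The finite rank comes from finite multiplicity (`finiteDimensional_of_coaction_mem`): if `α` maps
`Y` into `A ⊗ C` with `C` finite-dimensional, Bessel's inequality in `A ⊗ H` bounds the size of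
orthonormal families in `Y`.

For absolute simplicity, a nonzero finite-rank operator on a simple summand has an invariant image
on which any endomorphism has an eigenvalue, so endomorphisms are scalars. Jacobson density then
provides enough operators for simplicity to survive extension of scalars. -/

namespace HopfCoaction
open WithConv TensorProduct
open scoped Coalgebra ComplexConjugate

/-! ### Slice maps and separation of tensors by functionals. -/

section Slices

variable {k : Type*} [Field k] {H : Type*} [AddCommMonoid H] [Module k H]
variable {V : Type*} [AddCommMonoid V] [Module k V] {W : Type*} [AddCommMonoid W] [Module k W]

/-- The slice map `id ⊗ f : V ⊗ H → V` of a functional `f` on `H`. -/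
noncomputable def slice (V : Type*) [AddCommMonoid V] [Module k V] (f : H →ₗ[k] k) :
    V ⊗[k] H →ₗ[k] V :=
  (TensorProduct.rid k V).toLinearMap ∘ₗ f.lTensor V

@[simp] theorem slice_tmul (f : H →ₗ[k] k) (v : V) (h : H) :
    slice V f (v ⊗ₜ[k] h) = f h • v := by
  simp [slice]

theorem map_slice (f : H →ₗ[k] k) (g : V →ₗ[k] W) (t : V ⊗[k] H) :
    g (slice V f t) = slice W f (g.rTensor H t) := by
  induction t with
  | zero => simp
  | tmul v h => simp
  | add x y hx hy => simp [hx, hy]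

theorem slice_lTensor {H' : Type*} [AddCommMonoid H'] [Module k H'] (f : H' →ₗ[k] k)
    (g : H →ₗ[k] H') (t : V ⊗[k] H) :
    slice V f (g.lTensor V t) = slice V (f ∘ₗ g) t := by
  induction t with
  | zero => simp
  | tmul v h => simp
  | add x y hx hy => simp [hx, hy]

theorem lTensor_slice_assoc (f : H →ₗ[k] k) (t : (V ⊗[k] W) ⊗[k] H) :
    (slice W f).lTensor V (TensorProduct.assoc k V W H t) = slice (V ⊗[k] W) f t := by
  induction t with
  | zero => simp
  | tmul v h =>
    induction v with
    | zero => simp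
    | tmul v w => simp
    | add x y hx hy => simp_all [add_tmul]
  | add x y hx hy => simp [hx, hy]

theorem slice_congr {C : Submodule k H} {f g : H →ₗ[k] k} (hfg : ∀ x ∈ C, f x = g x)
    {t : V ⊗[k] H} (ht : t ∈ LinearMap.range (C.subtype.lTensor V)) :
    slice V f t = slice V g t := by
  obtain ⟨s, rfl⟩ := ht
  rw [slice_lTensor, slice_lTensor]
  congr 2
  ext x
  exact hfg x x.2

theorem slice_mem_of_mem_range_rTensor {X : Submodule k V} (f : H →ₗ[k] k) {t : V ⊗[k] H}
    (ht : t ∈ LinearMap.range (X.subtype.rTensor H)) : slice V f t ∈ X := by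
  obtain ⟨s, rfl⟩ := ht
  rw [← map_slice]
  exact Subtype.coe_prop _

theorem lTensor_mem_range_of_range_le {C : Submodule k W} {g : H →ₗ[k] W}
    (hg : LinearMap.range g ≤ C) (t : V ⊗[k] H) :
    g.lTensor V t ∈ LinearMap.range (C.subtype.lTensor V) := by
  refine ⟨(g.codRestrict C fun x => hg ⟨x, rfl⟩).lTensor V t, ?_⟩
  rw [← LinearMap.comp_apply, ← LinearMap.lTensor_comp, LinearMap.subtype_comp_codRestrict]

end Slices

section Separation

variable {k : Type*} [Field k] {H : Type*} [AddCommGroup H] [Module k H]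
variable {V : Type*} [AddCommGroup V] [Module k V] {W : Type*} [AddCommGroup W] [Module k W]

/-- Every tensor has its right leg in a finite-dimensional subspace. -/
theorem exists_finite_right_leg (t : V ⊗[k] H) :
    ∃ C : Submodule k H, FiniteDimensional k C ∧ t ∈ LinearMap.range (C.subtype.lTensor V) := by
  induction t with
  | zero => exact ⟨⊥, inferInstance, zero_mem _⟩
  | tmul v h =>
    exact ⟨k ∙ h, inferInstance, v ⊗ₜ ⟨h, Submodule.mem_span_singleton_self h⟩, by simp⟩
  | add x y hx hy =>
    obtain ⟨C, hC, s, rfl⟩ := hx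
    obtain ⟨D, hD, u, rfl⟩ := hy
    refine ⟨C ⊔ D, inferInstance, add_mem ?_ ?_⟩
    · refine ⟨(Submodule.inclusion le_sup_left).lTensor V s, ?_⟩
      rw [← LinearMap.comp_apply, ← LinearMap.lTensor_comp]
      rfl
    · refine ⟨(Submodule.inclusion le_sup_right).lTensor V u, ?_⟩
      rw [← LinearMap.comp_apply, ← LinearMap.lTensor_comp]
      rfl

/-- A tensor all of whose slices lie in `W` has its left leg in `W`. -/
theorem mem_range_rTensor_of_slice_mem {W : Submodule k V} {t : V ⊗[k] H}
    (h : ∀ f : H →ₗ[k] k, slice V f t ∈ W) : t ∈ LinearMap.range (W.subtype.rTensor H) := by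
  -- By exactness the range is the kernel of `V ⊗ H → (V/W) ⊗ H`. A tensor there vanishes once its
  -- coordinates in a basis of `H`, which are slices, vanish.
  have hex := rTensor_exact H (f := W.subtype) (g := W.mkQ)
    (by rw [LinearMap.exact_iff]; simp) (Submodule.mkQ_surjective W)
  rw [← hex.linearMap_ker_eq, LinearMap.mem_ker]
  have hs : ∀ f : H →ₗ[k] k, slice _ f (W.mkQ.rTensor H t) = 0 := fun f => by
    rw [← map_slice]
    simpa using h f
  generalize W.mkQ.rTensor H t = u at hs
  let b := Module.Free.chooseBasis k H
  apply (TensorProduct.equivFinsuppOfBasisRight b).injective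
  ext i
  rw [map_zero, Finsupp.zero_apply, ← hs (b.coord i)]
  clear hs
  induction u with
  | zero => simp
  | tmul v h => simp
  | add x y hx hy => simp [hx, hy]

/-- On a finite-dimensional subspace, a separating family of functionals represents every
functional. -/
theorem exists_eq_on_of_separating (B : W →ₗ[k] H →ₗ[k] k)
    (hB : ∀ x, (∀ w, B w x = 0) → x = 0) (C : Submodule k H) [FiniteDimensional k C]
    (f : H →ₗ[k] k) : ∃ w, ∀ x ∈ C, B w x = f x := by
  let r : W →ₗ[k] Module.Dual k C := (LinearMap.lcomp k k C.subtype) ∘ₗ B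
  have htop : LinearMap.range r = ⊤ := by
    have hbot : (LinearMap.range r).dualCoannihilator = ⊥ := by
      rw [eq_bot_iff]
      intro x hx
      rw [Submodule.mem_dualCoannihilator] at hx
      exact Subtype.ext (hB x fun w => hx (r w) ⟨w, rfl⟩)
    rw [← Subspace.dualCoannihilator_dualAnnihilator_eq (W := LinearMap.range r), hbot,
      Submodule.dualAnnihilator_bot]
  obtain ⟨w, hw⟩ := LinearMap.range_eq_top.1 htop (f ∘ₗ C.subtype)
  exact ⟨w, fun x hx => LinearMap.congr_fun hw ⟨x, hx⟩⟩

end Separation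

/-! ### Convolution operators, the antipode and the invariant integral. -/

section Comodule

variable {k : Type*} [Field k] {H : Type*} [Ring H] [HopfAlgebra k H]
variable {V : Type*} [AddCommGroup V] [Module k V]

/-- The operator `h ↦ h₁ f(h₂)`. -/
noncomputable def convOp (f : H →ₗ[k] k) : H →ₗ[k] H :=
  slice H f ∘ₗ Coalgebra.comul

theorem IsComodule.coaction_slice {δ : V →ₗ[k] V ⊗[k] H} (hδ : IsComodule δ) (f : H →ₗ[k] k)
    (v : V) : δ (slice V f (δ v)) = (convOp f).lTensor V (δ v) := by
  rw [map_slice, ← lTensor_slice_assoc, hδ.coassoc, convOp, LinearMap.lTensor_comp]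
  rfl

theorem IsComodule.slice_counit {δ : V →ₗ[k] V ⊗[k] H} (hδ : IsComodule δ) (v : V) :
    slice V Coalgebra.counit (δ v) = v := hδ.counit v

theorem isComodule_comul : IsComodule (Coalgebra.comul (R := k) (A := H)) where
  coassoc := Coalgebra.coassoc_apply
  counit v := by rw [Coalgebra.lTensor_counit_comul]; simp

end Comodule

section HopfAlgebra

variable {k : Type*} [Field k] {H : Type*} [Ring H] [HopfAlgebra k H]

/-- The operator `h ↦ f(h₁) h₂`. -/
noncomputable def convOpLeft (f : H →ₗ[k] k) : H →ₗ[k] H :=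
  (TensorProduct.lid k H).toLinearMap ∘ₗ f.rTensor H ∘ₗ Coalgebra.comul

theorem convOp_apply {ι : Type*} (f : H →ₗ[k] k) {a : H} (r : Coalgebra.Repr k a ι) :
    convOp f a = ∑ i ∈ r.index, f (r.right i) • r.left i := by
  simp [convOp, ← r.eq]

theorem convOpLeft_apply {ι : Type*} (f : H →ₗ[k] k) {a : H} (r : Coalgebra.Repr k a ι) :
    convOpLeft f a = ∑ i ∈ r.index, f (r.left i) • r.right i := by
  simp [convOpLeft, ← r.eq]

/-- Invariance of the integral for the algebra structure of `H`:
`b₁ φ(a b₂) = S(a₁) φ(a₂ b)`. -/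
theorem IsInvariantIntegral.convOp_mulLeft {φ : H →ₗ[k] k} (hφ : IsInvariantIntegral φ)
    (a b : H) : convOp (φ ∘ₗ LinearMap.mulLeft k a) b =
      HopfAlgebra.antipode k (convOp (φ ∘ₗ LinearMap.mulRight k b) a) := by
  let r := ℛ k b
  -- `Q(x) = φ(x b₂) b₁`. Invariance at `x b` says `id * Q = φ(· b) 1`; convolving with the antipode
  -- on the left solves for `Q`.
  let Q : WithConv (H →ₗ[k] H) :=
    toConv (∑ j ∈ r.index, (φ ∘ₗ LinearMap.mulRight k (r.right j)).smulRight (r.left j))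
  have hQ : toConv LinearMap.id * Q =
      toConv (Algebra.linearMap k H ∘ₗ φ ∘ₗ LinearMap.mulRight k b) := by
    ext x
    have h := hφ.invariant (x * b)
    rw [← ((ℛ k x).mul r).eq] at h
    rw [(ℛ k x).convMul_apply]
    simpa [Q, Finset.mul_sum, Finset.sum_product, Algebra.algebraMap_eq_smul_one] using h
  have hQ' : Q = toConv (HopfAlgebra.antipode k (A := H)) *
      toConv (Algebra.linearMap k H ∘ₗ φ ∘ₗ LinearMap.mulRight k b) := by
    rw [← hQ, ← mul_assoc, LinearMap.antipode_mul_id, one_mul]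
  have h := congr($hQ' a)
  rw [(ℛ k a).convMul_apply] at h
  rw [convOp_apply _ r, convOp_apply _ (ℛ k a), map_sum]
  simpa [Q, Algebra.algebraMap_eq_smul_one] using h

/-- The antipode is an anti-homomorphism of coalgebras. -/
theorem comul_antipode (h : H) : Coalgebra.comul (R := k) (HopfAlgebra.antipode k h) =
    TensorProduct.comm k H H (TensorProduct.map (HopfAlgebra.antipode k) (HopfAlgebra.antipode k)
      (Coalgebra.comul (R := k) h)) := by
  let iL : H →ₐ[k] H ⊗[k] H := Algebra.TensorProduct.includeLeft
  let iR : H →ₐ[k] H ⊗[k] H := Algebra.TensorProduct.includeRight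
  let S : H →ₗ[k] H := HopfAlgebra.antipode k
  have inv (i : H →ₐ[k] H ⊗[k] H) :
      toConv (i.toLinearMap ∘ₗ S) * toConv i.toLinearMap = 1 := by
    have := LinearMap.algHom_comp_convMul_distrib i (toConv S) (toConv LinearMap.id)
    rw [LinearMap.antipode_mul_id] at this
    apply_fun ofConv using WithConv.ofConv_injective
    simp only [LinearMap.comp_id] at this
    rw [← this]
    ext x
    simp [LinearMap.convOne_def]
  -- Both sides are convolution inverses of `Δ` among maps `H → H ⊗ H`: factoring `Δ` through the
  -- two embeddings of `H` gives a left inverse, and `Δ ∘ S` is a right inverse.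
  have hΔ : toConv (Coalgebra.comul (R := k) (A := H)) =
      toConv iL.toLinearMap * toConv iR.toLinearMap := by
    ext x
    rw [(ℛ k x).convMul_apply]
    simp [iL, iR, (ℛ k x).eq]
  have h1 : (toConv (iR.toLinearMap ∘ₗ S) * toConv (iL.toLinearMap ∘ₗ S)) *
      toConv (Coalgebra.comul (R := k) (A := H)) = 1 := by
    rw [hΔ, mul_assoc, ← mul_assoc (toConv (iL.toLinearMap ∘ₗ S)), inv, one_mul, inv]
  have h2 := congr($(left_inv_eq_right_inv h1 LinearMap.comul_right_inv) h)
  rw [(ℛ k h).convMul_apply] at h2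
  rw [← (ℛ k h).eq]
  simpa [iL, iR, S] using h2.symm

end HopfAlgebra

section OpConv
variable {H : Type*} [Ring H] [HopfAlgebra ℂ H]

/-- The convolution algebra of linear maps from `H` to its opposite algebra. -/
noncomputable def toOpConv (g : H →ₗ[ℂ] H) : WithConv (H →ₗ[ℂ] Hᵐᵒᵖ) :=
  toConv ((MulOpposite.opLinearEquiv ℂ).toLinearMap ∘ₗ g)

theorem toOpConv_mul_apply (f g : H →ₗ[ℂ] H) {ι : Type*} {h : H} (r : Coalgebra.Repr ℂ h ι) :
    (toOpConv f * toOpConv g) h =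
      MulOpposite.op (∑ i ∈ r.index, g (r.right i) * f (r.left i)) := by
  rw [r.convMul_apply]
  simp [toOpConv]

theorem toOpConv_apply (f : H →ₗ[ℂ] H) (h : H) : toOpConv f h = MulOpposite.op (f h) := rfl

end OpConv

/-! ### Hopf `*`-algebras: the inverse antipode and two-sided invariance. -/

section StarHopf
variable {H : Type*} [Ring H] [HopfAlgebra ℂ H] [StarRing H] [StarModule ℂ H]

/-- The linear map `h ↦ S(h*)*`, which is the inverse of the antipode of a Hopf `*`-algebra. -/
noncomputable def starAntipode (H : Type*) [Ring H] [HopfAlgebra ℂ H] [StarRing H]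
    [StarModule ℂ H] : H →ₗ[ℂ] H where
  toFun h := star (HopfAlgebra.antipode ℂ (star h))
  map_add' := by simp
  map_smul' := by simp

theorem starAntipode_apply (h : H) :
    starAntipode H h = star (HopfAlgebra.antipode ℂ (star h)) := rfl

/-- The star of a representation of `Δ(h)` is a representation of `Δ(h*)`. -/
noncomputable def starRepr (hcomul : ∀ h : H, Coalgebra.comul (R := ℂ) (star h) =
    star (Coalgebra.comul (R := ℂ) h)) {ι : Type*} {h : H} (r : Coalgebra.Repr ℂ h ι) :
    Coalgebra.Repr ℂ (star h) ι where
  index := r.index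
  left i := star (r.left i)
  right i := star (r.right i)
  eq := by simp [hcomul, ← r.eq]

/-- The functional `η(h) = conj ε(h*)` is a left counit, while `ε` is a right counit; evaluating
`η(h₁) ε(h₂)` in both ways gives `η = ε`. -/
theorem counit_star
    (hcomul : ∀ h : H, Coalgebra.comul (R := ℂ) (star h) = star (Coalgebra.comul (R := ℂ) h))
    (h : H) : Coalgebra.counit (R := ℂ) (star h) = star (Coalgebra.counit (R := ℂ) h) := by
  let r := ℛ ℂ h
  have h1 : ∑ i ∈ r.index, star (Coalgebra.counit (R := ℂ) (star (r.left i))) • r.right i = h := by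
    have := Coalgebra.sum_counit_smul (starRepr hcomul r)
    apply star_injective
    simpa [starRepr] using this
  have h2 := congr(Coalgebra.counit (R := ℂ) $h1)
  have h3 : ∑ i ∈ r.index, Coalgebra.counit (R := ℂ) (r.right i) • r.left i = h := by
    rw [← convOp_apply _ r]
    exact isComodule_comul.slice_counit h
  have h4 := congr(star (Coalgebra.counit (R := ℂ) (star $h3)))
  apply star_injective
  rw [star_star, ← h4, ← h2]
  simp [mul_comm]

theorem sum_starAntipode_mul
    (hcomul : ∀ h : H, Coalgebra.comul (R := ℂ) (star h) = star (Coalgebra.comul (R := ℂ) h))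
    {ι : Type*} {h : H} (r : Coalgebra.Repr ℂ h ι) :
    ∑ i ∈ r.index, starAntipode H (r.right i) * r.left i =
      algebraMap ℂ H (Coalgebra.counit (R := ℂ) h) := by
  have := HopfAlgebra.sum_mul_antipode_eq_algebraMap_counit (starRepr hcomul r)
  apply star_injective
  rw [counit_star hcomul] at this
  simpa [starRepr, starAntipode_apply, Algebra.algebraMap_eq_smul_one] using this

theorem sum_mul_starAntipode
    (hcomul : ∀ h : H, Coalgebra.comul (R := ℂ) (star h) = star (Coalgebra.comul (R := ℂ) h))
    {ι : Type*} {h : H} (r : Coalgebra.Repr ℂ h ι) :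
    ∑ i ∈ r.index, r.right i * starAntipode H (r.left i) =
      algebraMap ℂ H (Coalgebra.counit (R := ℂ) h) := by
  have := HopfAlgebra.sum_antipode_mul_eq_algebraMap_counit (starRepr hcomul r)
  apply star_injective
  rw [counit_star hcomul] at this
  simpa [starRepr, starAntipode_apply, Algebra.algebraMap_eq_smul_one] using this

theorem id_mul_starAntipode
    (hcomul : ∀ h : H, Coalgebra.comul (R := ℂ) (star h) = star (Coalgebra.comul (R := ℂ) h)) :
    toOpConv (LinearMap.id (M := H)) * toOpConv (starAntipode H) = 1 := by
  ext h
  rw [toOpConv_mul_apply _ _ (ℛ ℂ h)]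
  simp [sum_starAntipode_mul hcomul]

theorem starAntipode_mul_id
    (hcomul : ∀ h : H, Coalgebra.comul (R := ℂ) (star h) = star (Coalgebra.comul (R := ℂ) h)) :
    toOpConv (starAntipode H) * toOpConv (LinearMap.id (M := H)) = 1 := by
  ext h
  rw [toOpConv_mul_apply _ _ (ℛ ℂ h)]
  simp [sum_mul_starAntipode hcomul]

theorem starAntipode_antipode
    (hcomul : ∀ h : H, Coalgebra.comul (R := ℂ) (star h) = star (Coalgebra.comul (R := ℂ) h))
    (h : H) : starAntipode H (HopfAlgebra.antipode ℂ h) = h := by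
  -- With `T = starAntipode H`, both `T ∘ S` and the identity are inverse to `T` for convolution
  -- with reversed product, hence equal.
  have h1 : toOpConv (starAntipode H ∘ₗ HopfAlgebra.antipode ℂ) * toOpConv (starAntipode H) =
      1 := by
    ext h
    rw [toOpConv_mul_apply _ _ (ℛ ℂ h)]
    have hT (x y : H) : starAntipode H x * starAntipode H y = starAntipode H (y * x) := by
      simp [starAntipode_apply, HopfAlgebra.antipode_mul_antidistrib]
    simp only [LinearMap.comp_apply, hT, ← map_sum,
      HopfAlgebra.sum_antipode_mul_eq_algebraMap_counit]
    simp [starAntipode_apply, Algebra.algebraMap_eq_smul_one, HopfAlgebra.antipode_one]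
  exact MulOpposite.op_injective
    congr($(left_inv_eq_right_inv h1 (starAntipode_mul_id hcomul)) h)

theorem antipode_injective
    (hcomul : ∀ h : H, Coalgebra.comul (R := ℂ) (star h) = star (Coalgebra.comul (R := ℂ) h)) :
    Function.Injective (HopfAlgebra.antipode ℂ : H → H) :=
  Function.LeftInverse.injective (starAntipode_antipode hcomul)

/-- In a Hopf `*`-algebra an invariant integral is invariant on both sides. -/
theorem IsInvariantIntegral.convOpLeft_eq
    (hcomul : ∀ h : H, Coalgebra.comul (R := ℂ) (star h) = star (Coalgebra.comul (R := ℂ) h))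
    {φ : H →ₗ[ℂ] ℂ} (hφ : IsInvariantIntegral φ) (h : H) : convOpLeft φ h = φ h • (1 : H) := by
  let S : H →ₗ[ℂ] H := HopfAlgebra.antipode ℂ
  -- The antipode reverses `Δ`, so it turns invariance of `φ` into invariance of `φ ∘ S` on the
  -- other side.
  have hψ (h : H) : convOpLeft (φ ∘ₗ S) h = φ (S h) • (1 : H) := by
    apply antipode_injective hcomul
    have := hφ.invariant (S h)
    rw [comul_antipode, ← (ℛ ℂ h).eq] at this
    rw [convOpLeft_apply _ (ℛ ℂ h)]
    simpa [S, HopfAlgebra.antipode_one] using this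
  -- The number `φ(S h₁) φ(h₂)` equals `φ(S h)` by invariance of `φ ∘ S` and `φ(h)` by invariance of
  -- `φ`.
  have hS (h : H) : φ (S h) = φ h := by
    have h1 := congr(φ $(hψ h))
    have h2 := congr(φ (S $(hφ.invariant h)))
    rw [convOpLeft_apply _ (ℛ ℂ h)] at h1
    rw [← (ℛ ℂ h).eq] at h2
    simp [S, HopfAlgebra.antipode_one, hφ.normalized] at h1 h2
    rw [← h1, ← h2]
    exact Finset.sum_congr rfl fun _ _ => mul_comm _ _
  have hφS : φ ∘ₗ S = φ := LinearMap.ext hS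
  rw [← hS h, ← hψ h, hφS]

/-- Invariance of the integral for the algebra structure of `H`, on the other side:
`φ(a b₁) b₂ = φ(a₁ b) T(a₂)` for the inverse `T` of the antipode. -/
theorem IsInvariantIntegral.convOpLeft_mulLeft
    (hcomul : ∀ h : H, Coalgebra.comul (R := ℂ) (star h) = star (Coalgebra.comul (R := ℂ) h))
    {φ : H →ₗ[ℂ] ℂ} (hφ : IsInvariantIntegral φ) (a b : H) :
    convOpLeft (φ ∘ₗ LinearMap.mulLeft ℂ a) b =
      starAntipode H (convOpLeft (φ ∘ₗ LinearMap.mulRight ℂ b) a) := by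
  let r := ℛ ℂ b
  let Q : H →ₗ[ℂ] H :=
    ∑ j ∈ r.index, (φ ∘ₗ LinearMap.mulRight ℂ (r.left j)).smulRight (r.right j)
  let P : H →ₗ[ℂ] H := (φ ∘ₗ LinearMap.mulRight ℂ b).smulRight 1
  have hQ : toOpConv Q * toOpConv LinearMap.id = toOpConv P := by
    ext x
    have h := hφ.convOpLeft_eq hcomul (x * b)
    rw [convOpLeft_apply _ ((ℛ ℂ x).mul r)] at h
    rw [toOpConv_mul_apply _ _ (ℛ ℂ x)]
    apply MulOpposite.unop_injective
    simpa [P, Q, Finset.sum_mul, Finset.sum_product, toOpConv_apply] using h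
  have hQ' : toOpConv Q = toOpConv P * toOpConv (starAntipode H) := by
    rw [← hQ, mul_assoc, id_mul_starAntipode hcomul, mul_one]
  have h := congr(MulOpposite.unop ($hQ' a))
  rw [toOpConv_mul_apply _ _ (ℛ ℂ a)] at h
  rw [convOpLeft_apply _ r, convOpLeft_apply _ (ℛ ℂ a), map_sum]
  simpa [P, Q, toOpConv_apply] using h

/-- The operators `h ↦ h₁ φ(t h₂ u)` have finite rank. -/
theorem IsInvariantIntegral.exists_range_convOp_le
    (hcomul : ∀ h : H, Coalgebra.comul (R := ℂ) (star h) = star (Coalgebra.comul (R := ℂ) h))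
    {φ : H →ₗ[ℂ] ℂ} (hφ : IsInvariantIntegral φ) (t u : H) :
    ∃ C : Submodule ℂ H, FiniteDimensional ℂ C ∧
      LinearMap.range (convOp (φ ∘ₗ LinearMap.mulLeft ℂ t ∘ₗ LinearMap.mulRight ℂ u)) ≤ C := by
  let S : H →ₗ[ℂ] H := HopfAlgebra.antipode ℂ
  let rt := ℛ ℂ t
  let ru := ℛ ℂ u
  let X : Submodule ℂ H := Submodule.span ℂ ((fun i => S (rt.left i)) '' rt.index)
  let Y : Submodule ℂ H := Submodule.span ℂ ((fun i => starAntipode H (ru.left i)) '' ru.index)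
  have hX : X.FG := Submodule.fg_span (rt.index.finite_toSet.image _)
  have hY : Y.FG := Submodule.fg_span (ru.index.finite_toSet.image _)
  refine ⟨X * Y, Module.Finite.iff_fg.2 (hX.mul hY), ?_⟩
  rintro _ ⟨h, rfl⟩
  let rh := ℛ ℂ h
  -- The target is `h₁ φ(t h₂ u) = S(t₁) φ(t₂ h u₂) T(u₁)` with `T = starAntipode H`, which lies in
  -- `X * Y` for every `h`. Here `Q(x) = h₁ φ(t h₂ x)` and `P(x) = S(t₁) φ(t₂ h x)`, and
  -- `convOp_mulLeft` at `h x` relates them.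
  let Q : H →ₗ[ℂ] H := ∑ j ∈ rh.index,
    (φ ∘ₗ LinearMap.mulLeft ℂ t ∘ₗ LinearMap.mulLeft ℂ (rh.right j)).smulRight (rh.left j)
  let P : H →ₗ[ℂ] H := ∑ i ∈ rt.index,
    (φ ∘ₗ LinearMap.mulLeft ℂ (rt.right i) ∘ₗ LinearMap.mulLeft ℂ h).smulRight (S (rt.left i))
  have hQ : toOpConv LinearMap.id * toOpConv Q = toOpConv P := by
    ext x
    have h := hφ.convOp_mulLeft t (h * x)
    rw [convOp_apply _ (rh.mul (ℛ ℂ x)), convOp_apply _ rt] at h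
    rw [toOpConv_mul_apply _ _ (ℛ ℂ x)]
    apply MulOpposite.unop_injective
    simpa [P, Q, S, Finset.sum_mul, Finset.sum_product_right, toOpConv_apply, mul_assoc] using h
  have hQ' : toOpConv Q = toOpConv (starAntipode H) * toOpConv P := by
    rw [← hQ, ← mul_assoc, starAntipode_mul_id hcomul, one_mul]
  have h2 := congr(MulOpposite.unop ($hQ' u))
  rw [toOpConv_mul_apply _ _ ru, MulOpposite.unop_op, toOpConv_apply, MulOpposite.unop_op] at h2
  have h3 : convOp (φ ∘ₗ LinearMap.mulLeft ℂ t ∘ₗ LinearMap.mulRight ℂ u) h = Q u := by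
    rw [convOp_apply _ rh]
    simp [Q]
  rw [h3, h2]
  refine sum_mem fun i hi => Submodule.mul_mem_mul ?_ (Submodule.subset_span ⟨i, hi, rfl⟩)
  simp only [P, LinearMap.sum_apply, LinearMap.smulRight_apply]
  exact sum_mem fun j hj => Submodule.smul_mem _ _ (Submodule.subset_span ⟨j, hj, rfl⟩)

end StarHopf

/-! ### Positive functionals, their tensor product, and faithfulness of the integral. -/

section StarAlgebra

variable {B : Type*} [Ring B] [Algebra ℂ B] [StarRing B] [StarModule ℂ B]

/-- A positive functional on a `*`-algebra is hermitian. -/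
theorem conj_apply_star_mul {φ : B →ₗ[ℂ] ℂ} (hφ : ∀ b, 0 ≤ φ (star b * b)) (x y : B) :
    conj (φ (star x * y)) = φ (star y * x) := by
  have him (b : B) : (φ (star b * b)).im = 0 := ((Complex.nonneg_iff.1 (hφ b)).2).symm
  have hx := him x
  have hy := him y
  -- Polarization: reality of `φ(b* b)` at `x + y` and `x + i y` gives the imaginary and real parts
  -- of the claim.
  have h1 := him (x + y)
  have h2 := him (x + Complex.I • y)
  simp only [star_add, add_mul, mul_add, map_add, Complex.add_im, hx, hy, star_smul,
    smul_mul_assoc, mul_smul_comm, map_smul, smul_eq_mul] at h1 h2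
  simp at h2
  apply Complex.ext
  · simp; linarith
  · simp; linarith

theorem map_star_of_nonneg {φ : B →ₗ[ℂ] ℂ} (hφ : ∀ b, 0 ≤ φ (star b * b)) (x : B) :
    φ (star x) = conj (φ x) := by
  simpa using (conj_apply_star_mul hφ 1 x).symm

/-- The inner product `⟨x, y⟩ = φ(x* y)` of a faithful positive functional. -/
noncomputable abbrev innerCore (φ : B →ₗ[ℂ] ℂ) (hφ : ∀ b, 0 ≤ φ (star b * b))
    (hφ_def : ∀ b, φ (star b * b) = 0 → b = 0) : InnerProductSpace.Core ℂ B where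
  inner x y := φ (star x * y)
  conj_inner_symm x y := conj_apply_star_mul hφ y x
  re_inner_nonneg x := (Complex.nonneg_iff.1 (hφ x)).1
  add_left x y z := by simp [add_mul]
  smul_left x y r := by simp
  definite := hφ_def

end StarAlgebra

section TensorFunctional

variable {A : Type*} [Ring A] [Algebra ℂ A] [StarRing A] [StarModule ℂ A]
variable {H : Type*} [Ring H] [Algebra ℂ H] [StarRing H] [StarModule ℂ H]

/-- The functional `φA ⊗ φ` on `A ⊗ H`. -/
noncomputable def tensorFunctional (φA : A →ₗ[ℂ] ℂ) (φ : H →ₗ[ℂ] ℂ) : A ⊗[ℂ] H →ₗ[ℂ] ℂ :=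
  φA ∘ₗ slice A φ

/-- The form defined by `φA ⊗ φ` is the tensor product of two inner products, hence itself an inner
product. -/
theorem tensorFunctional_star_mul_self (φA : A →ₗ[ℂ] ℂ) (hφA : ∀ b, 0 ≤ φA (star b * b))
    (hφA_def : ∀ b, φA (star b * b) = 0 → b = 0) (φ : H →ₗ[ℂ] ℂ)
    (hφ : ∀ b, 0 ≤ φ (star b * b)) (hφ_def : ∀ b, φ (star b * b) = 0 → b = 0) (x : A ⊗[ℂ] H) :
    0 ≤ tensorFunctional φA φ (star x * x) ∧
      (tensorFunctional φA φ (star x * x) = 0 → x = 0) := by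
  let cA := innerCore φA hφA hφA_def
  let cH := innerCore φ hφ hφ_def
  let nA : NormedAddCommGroup A := cA.toNormedAddCommGroup
  let nH : NormedAddCommGroup H := cH.toNormedAddCommGroup
  let iA : InnerProductSpace ℂ A := .ofCore cA.toCore
  let iH : InnerProductSpace ℂ H := .ofCore cH.toCore
  have key (x y : A ⊗[ℂ] H) : tensorFunctional φA φ (star x * y) = inner ℂ x y := by
    induction x with
    | zero => simp
    | add u v hu hv => rw [star_add, add_mul, map_add, hu, hv, inner_add_left]
    | tmul a h =>
      induction y with
      | zero => simp
      | add u v hu hv => rw [mul_add, map_add, hu, hv, inner_add_right]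
      | tmul b g =>
        rw [TensorProduct.inner_tmul]
        simp only [tensorFunctional, star_tmul, Algebra.TensorProduct.tmul_mul_tmul,
          LinearMap.comp_apply, slice_tmul, map_smul, smul_eq_mul]
        exact mul_comm _ _
  rw [key]
  exact ⟨le_of_le_of_eq (b := (‖x‖ : ℂ) ^ 2) (by norm_cast; positivity)
    (inner_self_eq_norm_sq_to_K (𝕜 := ℂ) x).symm, fun h => inner_self_eq_zero.1 h⟩

end TensorFunctional

section Faithful
variable {H : Type*} [Ring H] [HopfAlgebra ℂ H] [StarRing H] [StarModule ℂ H]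

theorem convOp_convOpLeft {k H : Type*} [Field k] [Ring H] [HopfAlgebra k H]
    (f g : H →ₗ[k] k) (h : H) : g (convOp f h) = f (convOpLeft g h) := by
  rw [convOp_apply _ (ℛ k h), convOpLeft_apply _ (ℛ k h)]
  simp [mul_comm]

/-- An invariant integral is nondegenerate. -/
theorem IsInvariantIntegral.eq_zero {k H : Type*} [Field k] [Ring H] [HopfAlgebra k H]
    {φ : H →ₗ[k] k} (hφ : IsInvariantIntegral φ) {h : H} (hh : ∀ g, φ (g * h) = 0) : h = 0 := by
  -- The radical of the form `φ(g h)` is stable under `n ↦ f(n₁) n₂`, by `convOp_mulLeft`.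
  have key (n : H) (hn : ∀ g, φ (g * n) = 0) (f : H →ₗ[k] k) (g : H) :
      φ (g * convOpLeft f n) = 0 := by
    have h0 : φ ∘ₗ LinearMap.mulRight k n = 0 := LinearMap.ext hn
    have := hφ.convOp_mulLeft g n
    rw [h0] at this
    change (φ ∘ₗ LinearMap.mulLeft k g) (convOpLeft f n) = 0
    rw [← convOp_convOpLeft, this]
    simp [convOp, slice]
  -- Stability puts the second leg of `Δ(n)` in the radical `N`, so `ε(n) = φ(S(n₁) n₂) = 0`.
  have counit_eq (n : H) (hn : ∀ g, φ (g * n) = 0) : Coalgebra.counit (R := k) n = 0 := by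
    let N : Submodule k H := ⨅ g, LinearMap.ker (φ ∘ₗ LinearMap.mulLeft k g)
    have hN (y : H) (hy : ∀ g, φ (g * y) = 0) : y ∈ N := by simpa [N] using hy
    obtain ⟨s, hs⟩ := mem_range_rTensor_of_slice_mem (W := N)
      (t := TensorProduct.comm k H H (Coalgebra.comul (R := k) n)) fun f => by
        convert hN _ (key n hn f)
        rw [convOpLeft, LinearMap.comp_apply, LinearMap.comp_apply]
        generalize Coalgebra.comul (R := k) n = t
        induction t with
        | zero => simp
        | tmul x y => simp
        | add x y hx hy => simp_all
    have h1 := congr(φ $(HopfAlgebra.mul_antipode_rTensor_comul_apply (R := k) n))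
    rw [(TensorProduct.comm k H H).eq_symm_apply.2 hs.symm] at h1
    rw [Algebra.algebraMap_eq_smul_one, map_smul, hφ.normalized, smul_eq_mul, mul_one] at h1
    rw [← h1]
    clear hs h1
    induction s with
    | zero => simp
    | tmul x y =>
      have := x.2
      simp only [N, Submodule.mem_iInf, LinearMap.mem_ker] at this
      simpa using this (HopfAlgebra.antipode k y)
    | add x y hx hy => simp_all
  rw [← Module.forall_dual_apply_eq_zero_iff k]
  intro f
  have h1 := isComodule_comul (k := k).slice_counit h
  change convOp _ h = h at h1
  rw [← h1, convOp_convOpLeft]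
  exact counit_eq _ (key h hh f)

/-- A positive invariant integral is faithful. -/
theorem IsInvariantIntegral.faithful {φ : H →ₗ[ℂ] ℂ} (hφ : IsInvariantIntegral φ)
    (hφ_pos : ∀ h, 0 ≤ φ (star h * h)) (h : H) (hh : φ (star h * h) = 0) : h = 0 := by
  apply hφ.eq_zero
  intro g
  -- Cauchy–Schwarz for the semidefinite form: a null vector is orthogonal to everything, hence in
  -- the radical.
  let c : PreInnerProductSpace.Core ℂ H :=
    { inner x y := φ (star x * y)
      conj_inner_symm x y := conj_apply_star_mul hφ_pos y x
      re_inner_nonneg x := (Complex.nonneg_iff.1 (hφ_pos x)).1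
      add_left x y z := by simp [add_mul]
      smul_left x y r := by simp }
  have h1 : ‖φ (star (star g) * h)‖ * ‖φ (star h * star g)‖ ≤
      (φ (star (star g) * star g)).re * (φ (star h * h)).re :=
    InnerProductSpace.Core.inner_mul_inner_self_le (c := c) (star g) h
  rw [← conj_apply_star_mul hφ_pos (star g) h, Complex.norm_conj, hh, Complex.zero_re, mul_zero,
    star_star, ← sq] at h1
  exact norm_eq_zero.1 (pow_eq_zero_iff two_ne_zero |>.1 (le_antisymm h1 (sq_nonneg _)))

end Faithful

section Adjoint
variable {H : Type*} [Ring H] [HopfAlgebra ℂ H] [StarRing H] [StarModule ℂ H]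

/-- The functional `h ↦ conj f(S(h)*)`. -/
noncomputable def dualStar (f : H →ₗ[ℂ] ℂ) : H →ₗ[ℂ] ℂ where
  toFun h := conj (f (star (HopfAlgebra.antipode ℂ h)))
  map_add' := by simp
  map_smul' := by simp

/-- The adjoint of `h ↦ h₁ f(h₂)` for the inner product `φ(x* y)`. -/
theorem IsInvariantIntegral.apply_star_convOp_mul
    (hcomul : ∀ h : H, Coalgebra.comul (R := ℂ) (star h) = star (Coalgebra.comul (R := ℂ) h))
    {φ : H →ₗ[ℂ] ℂ} (hφ : IsInvariantIntegral φ) (f : H →ₗ[ℂ] ℂ) (x y : H) :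
    φ (star (convOp (dualStar f) x) * y) = φ (star x * convOp f y) := by
  have h := congr(f $(hφ.convOpLeft_mulLeft hcomul (star x) y))
  rw [← convOp_convOpLeft, convOpLeft_apply _ (starRepr hcomul (ℛ ℂ x))] at h
  change φ (star x * convOp f y) = _ at h
  rw [h, convOp_apply _ (ℛ ℂ x)]
  simp [starRepr, dualStar, starAntipode_apply, Finset.sum_mul, mul_comm]

end Adjoint

section SliceStar

variable {A : Type*} [Ring A] [Algebra ℂ A] {H : Type*} [Ring H] [Algebra ℂ H]

theorem slice_tmul_one_mul (f : H →ₗ[ℂ] ℂ) (a : A) (x : A ⊗[ℂ] H) :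
    slice A f ((a ⊗ₜ[ℂ] (1 : H)) * x) = a * slice A f x := by
  induction x with
  | zero => simp
  | tmul b h => simp
  | add x y hx hy => simp only [mul_add, map_add, hx, hy]

theorem slice_mul_tmul_one (f : H →ₗ[ℂ] ℂ) (a : A) (x : A ⊗[ℂ] H) :
    slice A f (x * (a ⊗ₜ[ℂ] (1 : H))) = slice A f x * a := by
  induction x with
  | zero => simp
  | tmul b h => simp
  | add x y hx hy => simp only [add_mul, map_add, hx, hy]

theorem slice_one_tmul_mul (f : H →ₗ[ℂ] ℂ) (h : H) (x : A ⊗[ℂ] H) :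
    slice A f (((1 : A) ⊗ₜ[ℂ] h) * x) = slice A (f ∘ₗ LinearMap.mulLeft ℂ h) x := by
  induction x with
  | zero => simp
  | tmul b h => simp
  | add x y hx hy => simp only [mul_add, map_add, hx, hy]

theorem slice_mul_one_tmul (f : H →ₗ[ℂ] ℂ) (h : H) (x : A ⊗[ℂ] H) :
    slice A f (x * ((1 : A) ⊗ₜ[ℂ] h)) = slice A (f ∘ₗ LinearMap.mulRight ℂ h) x := by
  induction x with
  | zero => simp
  | tmul b h => simp
  | add x y hx hy => simp only [add_mul, map_add, hx, hy]

theorem slice_star [StarRing A] [StarModule ℂ A] [StarRing H] [StarModule ℂ H] {f : H →ₗ[ℂ] ℂ}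
    (hf : ∀ h, 0 ≤ f (star h * h)) (x : A ⊗[ℂ] H) :
    slice A f (star x) = star (slice A f x) := by
  induction x with
  | zero => simp
  | tmul b h => simp [map_star_of_nonneg hf]
  | add x y hx hy => simp only [star_add, map_add, hx, hy]

end SliceStar

/-! ### Bessel's inequality and finite multiplicity. -/

/-- The data of a `*`-preserving coaction `α` of a Hopf `*`-algebra with a positive invariant
integral `φ` for which `(id ⊗ φ) α = φA(·) 1` for a faithful positive functional `φA`. -/
structure IsPositiveCoaction {H : Type uH} [Ring H] [HopfAlgebra ℂ H] [StarRing H] [StarModule ℂ H]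
    {A : Type uA} [Ring A] [Algebra ℂ A] [StarRing A] [StarModule ℂ A]
    (φ : H →ₗ[ℂ] ℂ) (φA : A →ₗ[ℂ] ℂ) (α : A →ₐ[ℂ] A ⊗[ℂ] H) : Prop where
  comul_star : ∀ h : H, Coalgebra.comul (R := ℂ) (star h) = star (Coalgebra.comul (R := ℂ) h)
  integral : IsInvariantIntegral φ
  nonneg : ∀ h : H, 0 ≤ φ (star h * h)
  comodule : IsComodule α.toLinearMap
  coaction_star : ∀ a : A, α (star a) = star (α a)
  slice_coaction : ∀ a : A, slice A φ (α a) = φA a • (1 : A)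
  nonneg' : ∀ a : A, 0 ≤ φA (star a * a)
  definite' : ∀ a : A, φA (star a * a) = 0 → a = 0

namespace IsPositiveCoaction

variable {H : Type uH} [Ring H] [HopfAlgebra ℂ H] [StarRing H] [StarModule ℂ H]
    {A : Type uA} [Ring A] [Algebra ℂ A] [StarRing A] [StarModule ℂ A]
    {φ : H →ₗ[ℂ] ℂ} {φA : A →ₗ[ℂ] ℂ} {α : A →ₐ[ℂ] A ⊗[ℂ] H}

theorem tensorFunctional_nonneg (P : IsPositiveCoaction φ φA α) (x : A ⊗[ℂ] H) :
    0 ≤ tensorFunctional φA φ (star x * x) :=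
  (tensorFunctional_star_mul_self φA P.nonneg' P.definite' φ P.nonneg
    (P.integral.faithful P.nonneg) x).1

theorem tensorFunctional_definite (P : IsPositiveCoaction φ φA α) (x : A ⊗[ℂ] H)
    (hx : tensorFunctional φA φ (star x * x) = 0) : x = 0 :=
  (tensorFunctional_star_mul_self φA P.nonneg' P.definite' φ P.nonneg
    (P.integral.faithful P.nonneg) x).2 hx

/-- Bessel's inequality in `A ⊗ H` for `1 ⊗ c` and the orthonormal vectors `α(y i)`. -/
theorem sum_apply_mul_star_le (P : IsPositiveCoaction φ φA α) {ι : Type*} [Fintype ι]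
    [DecidableEq ι] (y : ι → A) (hy : ∀ i j, φA (star (y i) * y j) = if i = j then 1 else 0)
    (c : H) (hc : ∀ i, slice A (φ ∘ₗ LinearMap.mulLeft ℂ (star c)) (α (y i)) = y i) :
    ∑ i, (φA (y i * star (y i))).re ≤ (φ (star c * c) * φA 1).re := by
  set z : A ⊗[ℂ] H := 1 ⊗ₜ c with hz
  set s : A := ∑ i, y i * star (y i) with hs
  -- For the `A`-valued form `⟨x, w⟩ = (id ⊗ φ)(x* w)` the `α(y i)` are orthonormal and `hc` gives
  -- `⟨α(y i), z⟩ = (y i)*`. Thus `v` is the projection of `z` onto their span, and positivity at `z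
  -- - v` is Bessel's inequality.
  set v : A ⊗[ℂ] H := ∑ i, α (y i) * (star (y i) ⊗ₜ 1) with hv
  have hzz : slice A φ (star z * z) = φ (star c * c) • (1 : A) := by simp [hz]
  have hzv : slice A φ (star z * v) = s := by
    simp only [hz, hv, hs, Finset.mul_sum, map_sum, star_tmul, star_one, ← mul_assoc,
      slice_mul_tmul_one, slice_one_tmul_mul, hc]
  have hvz : slice A φ (star v * z) = s := by
    rw [← star_star z, ← star_mul, slice_star P.nonneg, hzv]
    simp [hs]
  have hvv : slice A φ (star v * v) = s := by
    have (i j : ι) : star (α (y i) * (star (y i) ⊗ₜ 1)) * (α (y j) * (star (y j) ⊗ₜ 1)) =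
        (y i ⊗ₜ 1) * (α (star (y i) * y j) * (star (y j) ⊗ₜ[ℂ] (1 : H))) := by
      rw [star_mul, map_mul, P.coaction_star]
      simp [mul_assoc]
    simp only [hv, hs, star_sum, Finset.sum_mul_sum, map_sum, this, slice_tmul_one_mul,
      slice_mul_tmul_one, P.slice_coaction, hy]
    simp
  have h := P.tensorFunctional_nonneg (z - v)
  have he : slice A φ (star (z - v) * (z - v)) = φ (star c * c) • (1 : A) - s := by
    rw [star_sub, sub_mul, mul_sub, mul_sub, map_sub, map_sub, map_sub, hzz, hzv, hvz, hvv,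
      sub_self, sub_zero]
  rw [tensorFunctional, LinearMap.comp_apply, he, map_sub, map_smul, smul_eq_mul] at h
  have h2 := (Complex.nonneg_iff.1 h).1
  rw [Complex.sub_re, hs, map_sum, Complex.re_sum] at h2
  linarith

/-- The one-vector case of Bessel's inequality, rescaled to a `y` of arbitrary norm. -/
theorem apply_mul_star_le (P : IsPositiveCoaction φ φA α) (y : A) (c : H)
    (hc : slice A (φ ∘ₗ LinearMap.mulLeft ℂ (star c)) (α y) = y) :
    (φA (y * star y)).re ≤ (φ (star c * c) * φA 1).re * (φA (star y * y)).re := by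
  rcases eq_or_ne y 0 with rfl | hy0
  · simp
  obtain ⟨h0, him⟩ := Complex.nonneg_iff.1 (P.nonneg' y)
  have hpos : 0 < (φA (star y * y)).re := lt_of_le_of_ne h0 fun h =>
    hy0 (P.definite' y (Complex.ext h.symm him.symm))
  set n := (φA (star y * y)).re with hn
  have hnC : φA (star y * y) = (n : ℂ) := Complex.ext rfl him.symm
  let r : ℂ := ((Real.sqrt n)⁻¹ : ℝ)
  have hr : r * r = (n : ℂ)⁻¹ := by
    simp only [r]
    rw [← Complex.ofReal_mul, ← mul_inv, Real.mul_self_sqrt hpos.le, Complex.ofReal_inv]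
  have hrs : star r = r := Complex.conj_ofReal _
  have h := P.sum_apply_mul_star_le (ι := Unit) (fun _ => r • y) (fun i j => by
    simp only [star_smul, hrs, smul_mul_smul_comm, map_smul, hr, hnC, smul_eq_mul]
    rw [inv_mul_cancel₀ (by exact_mod_cast hpos.ne'), if_pos trivial]) c
    (fun _ => by simp only [map_smul, hc])
  simp only [star_smul, hrs, smul_mul_smul_comm, map_smul, hr, smul_eq_mul, Finset.univ_unique,
    Finset.sum_const, Finset.card_singleton, one_smul] at h
  rw [← Complex.ofReal_inv, Complex.re_ofReal_mul, inv_mul_le_iff₀ hpos] at h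
  linarith

/-- Finite multiplicity: a subspace of `A` that `α` maps into `A ⊗ C` for a finite-dimensional
`C` is itself finite-dimensional. -/
theorem finiteDimensional_of_coaction_mem (P : IsPositiveCoaction φ φA α) (Y : Submodule ℂ A)
    (C : Submodule ℂ H) [FiniteDimensional ℂ C]
    (hY : ∀ y ∈ Y, α y ∈ LinearMap.range (C.subtype.lTensor A)) : FiniteDimensional ℂ Y := by
  have hsep := P.integral.faithful P.nonneg
  -- On `C` both `φ(c ·)` and `φ(· d)` equal the counit; `c` serves the elements of `Y`, and `d`
  -- serves their stars.
  obtain ⟨c, hc⟩ := exists_eq_on_of_separating ((LinearMap.mul ℂ H).compr₂ φ)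
    (fun x hx => hsep x (hx (star x))) C Coalgebra.counit
  obtain ⟨d, hd⟩ := exists_eq_on_of_separating ((LinearMap.mul ℂ H).flip.compr₂ φ)
    (fun x hx => star_eq_zero.1 (hsep (star x) (by simpa using hx (star x)))) C Coalgebra.counit
  have hcY (y : A) (hy : y ∈ Y) :
      slice A (φ ∘ₗ LinearMap.mulLeft ℂ (star (star c))) (α y) = y := by
    rw [star_star]
    exact (slice_congr (fun x hx => hc x hx) (hY y hy)).trans (P.comodule.slice_counit y)
  have hdY (y : A) (hy : y ∈ Y) :
      slice A (φ ∘ₗ LinearMap.mulLeft ℂ (star d)) (α (star y)) = star y := by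
    rw [P.coaction_star, ← slice_one_tmul_mul, ← star_one, ← star_tmul, ← star_mul,
      slice_star P.nonneg, slice_mul_one_tmul]
    congr 1
    exact (slice_congr (fun x hx => hd x hx) (hY y hy)).trans (P.comodule.slice_counit y)
  set K := (φ (star (star c) * star c) * φA 1).re
  set K' := (φ (star d * d) * φA 1).re
  have bound (n : ℕ) (y : Fin n → A) (hyY : ∀ i, y i ∈ Y)
      (hy : ∀ i j, φA (star (y i) * y j) = if i = j then 1 else 0) : (n : ℝ) ≤ K' * K := by
    have h1 := P.sum_apply_mul_star_le y hy (star c) fun i => hcY _ (hyY i)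
    -- Applied to `(y i)*`, the one-vector inequality bounds `φA(y i (y i)*)` from below; `h1`
    -- bounds the sum of these from above.
    have h2 (i : Fin n) : 1 ≤ K' * (φA (y i * star (y i))).re := by
      have := P.apply_mul_star_le (star (y i)) d (hdY _ (hyY i))
      rwa [star_star, hy, if_pos rfl, Complex.one_re] at this
    have hK' : 0 ≤ K' := by
      have := P.sum_apply_mul_star_le (ι := Empty) (fun i => i.elim) (fun i => i.elim) d
        (fun i => i.elim)
      rwa [Finset.univ_eq_empty, Finset.sum_empty] at this
    calc (n : ℝ) = ∑ i : Fin n, 1 := by simp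
      _ ≤ ∑ i, K' * (φA (y i * star (y i))).re := Finset.sum_le_sum fun i _ => h2 i
      _ = K' * ∑ i, (φA (y i * star (y i))).re := by rw [Finset.mul_sum]
      _ ≤ K' * K := mul_le_mul_of_nonneg_left h1 hK'
  obtain ⟨N, hN⟩ := exists_nat_gt (K' * K)
  let cA := innerCore φA P.nonneg' P.definite'
  let nA : NormedAddCommGroup A := cA.toNormedAddCommGroup
  let iA : InnerProductSpace ℂ A := .ofCore cA.toCore
  by_contra hfin
  have hrank : (N : Cardinal) ≤ Module.rank ℂ Y :=
    (Cardinal.natCast_lt_aleph0).le.trans (not_lt.1 fun h => hfin (Module.rank_lt_aleph0_iff.1 h))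
  obtain ⟨s, hs, hli⟩ := le_rank_iff_exists_linearIndependent_finset.1 hrank
  let e : Fin N → s := (s.equivFinOfCardEq hs).symm
  let f : Fin N → A := fun i => ((e i : Y) : A)
  have hf : LinearIndependent ℂ f :=
    (hli.map' Y.subtype (Submodule.ker_subtype Y)).comp e (Equiv.injective _)
  have ho := InnerProductSpace.gramSchmidtNormed_orthonormal (𝕜 := ℂ) hf
  have hmem (i : Fin N) : InnerProductSpace.gramSchmidtNormed ℂ f i ∈ Y := by
    have h1 : InnerProductSpace.gramSchmidtNormed ℂ f i ∈ Submodule.span ℂ (Set.range f) := by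
      rw [← InnerProductSpace.span_gramSchmidt ℂ f,
        ← InnerProductSpace.span_gramSchmidtNormed_range]
      exact Submodule.subset_span ⟨i, rfl⟩
    refine Submodule.span_le.2 ?_ h1
    rintro _ ⟨j, rfl⟩
    exact (e j : Y).2
  exact absurd (bound N _ hmem (orthonormal_iff_ite.1 ho)) (not_le.2 hN)

end IsPositiveCoaction

/-! ### Semisimplicity, Schur's lemma and density from finite-rank elements. -/

section Semisimple

variable {R : Type*} [Ring R] [Algebra ℂ R]
variable {V : Type*} [AddCommGroup V] [Module ℂ V] [Module R V] [IsScalarTower ℂ R V]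

/-- A module with an invariant inner product is semisimple if each of its elements is fixed by
a ring element that acts with finite rank. -/
theorem isSemisimpleModule_of_adjoint_of_finiteRank (c : InnerProductSpace.Core ℂ V)
    (hadj : ∀ r : R, ∃ r' : R, ∀ x y, c.inner (r • x) y = c.inner x (r' • y))
    (hfin : ∀ v : V, ∃ e : R, e • v = v ∧
      ∃ F : Submodule ℂ V, FiniteDimensional ℂ F ∧ ∀ w : V, e • w ∈ F) :
    IsSemisimpleModule R V := by
  let nV : NormedAddCommGroup V := c.toNormedAddCommGroup
  let iV : InnerProductSpace ℂ V := .ofCore c.toCore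
  have hadj' (r : R) : ∃ r' : R, ∀ x y : V, inner ℂ (r • x) y = inner ℂ x (r' • y) := hadj r
  rw [isSemisimpleModule_iff]
  refine ⟨fun N => ?_⟩
  let N' : Submodule R V :=
    { carrier := {x | ∀ n ∈ N, inner ℂ n x = 0}
      add_mem' := fun {x y} hx hy n hn => by rw [inner_add_right, hx n hn, hy n hn, add_zero]
      zero_mem' := fun n _ => inner_zero_right n
      smul_mem' := fun r x hx n hn => by
        obtain ⟨r', hr'⟩ := hadj' r
        rw [← inner_conj_symm, hr', inner_conj_symm]
        exact hx _ (N.smul_mem r' hn) }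
  refine ⟨N', ?_, ?_⟩
  · rw [Submodule.disjoint_def]
    exact fun x hx hx' => inner_self_eq_zero.1 (hx' x hx)
  · rw [codisjoint_iff, eq_top_iff]
    rintro v -
    obtain ⟨e, hev, F, hF, heF⟩ := hfin v
    obtain ⟨e', he'⟩ := hadj' e
    -- The range of `e` lies in `F`, so its adjoint `e'` kills the orthogonal complement of `F`.
    -- Hence `e' N` lies in the finite-dimensional `G`.
    have hproj (y : V) : e' • y = e' • (F.starProjection y) := by
      rw [← sub_eq_zero, ← smul_sub]
      apply ext_inner_left ℂ
      intro x
      rw [← he', inner_zero_right]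
      exact Submodule.sub_starProjection_mem_orthogonal (K := F) y _ (heF x)
    let G : Submodule ℂ V := F.map (Algebra.lsmul ℂ ℂ V e') ⊓ N.restrictScalars ℂ
    have hG (n : V) (hn : n ∈ N) : e' • n ∈ G :=
      ⟨⟨F.starProjection n, Submodule.starProjection_apply_mem F n, (hproj n).symm⟩,
        N.smul_mem e' hn⟩
    have : FiniteDimensional ℂ G := Submodule.finiteDimensional_of_le inf_le_left
    have hw : G.starProjection v ∈ N := (Submodule.starProjection_apply_mem G v).2
    -- With `w` the projection of `v` to `G`, the vector `v - e w = e (v - w)` is orthogonal to `N`,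
    -- since `e' N ⊆ G`.
    rw [← add_sub_cancel (e • G.starProjection v) v]
    refine Submodule.add_mem_sup (N.smul_mem e hw) fun n hn => ?_
    nth_rw 1 [← hev]
    rw [← smul_sub, ← inner_conj_symm, he', inner_conj_symm]
    exact Submodule.sub_starProjection_mem_orthogonal (K := G) v _ (hG n hn)

/-- Finite rank is needed only on cyclic submodules: each inherits the form and is semisimple, and
they span `V`. -/
theorem isSemisimpleModule_of_adjoint_of_cyclic (c : InnerProductSpace.Core ℂ V)
    (hadj : ∀ r : R, ∃ r' : R, ∀ x y, c.inner (r • x) y = c.inner x (r' • y))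
    (hfin : ∀ m v : V, ∃ e : R, e • v = v ∧
      ∃ F : Submodule ℂ V, FiniteDimensional ℂ F ∧ ∀ r : R, e • r • m ∈ F) :
    IsSemisimpleModule R V := by
  refine isSemisimpleModule_of_isSemisimpleModule_submodule' (p := fun m : V => R ∙ m)
    (fun m => ?_) ?_
  · let c' : InnerProductSpace.Core ℂ (R ∙ m) :=
      { inner x y := c.inner x y
        conj_inner_symm x y := c.conj_inner_symm x y
        re_inner_nonneg x := c.re_inner_nonneg x
        add_left x y z := c.add_left x y z
        smul_left x y r := c.smul_left x y r
        definite x hx := Subtype.ext (c.definite x hx) }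
    refine isSemisimpleModule_of_adjoint_of_finiteRank c' (fun r => ?_) fun v => ?_
    · obtain ⟨r', hr'⟩ := hadj r
      exact ⟨r', fun x y => hr' x y⟩
    · obtain ⟨e, he, F, hF, heF⟩ := hfin m v
      refine ⟨e, Subtype.ext he, F.comap ((R ∙ m).subtype.restrictScalars ℂ), ?_, fun w => ?_⟩
      · exact Module.Finite.of_injective
          (((R ∙ m).subtype.restrictScalars ℂ).restrict
            (p := F.comap ((R ∙ m).subtype.restrictScalars ℂ)) (q := F) fun x hx => hx)
          fun x y h => Subtype.ext (Subtype.ext congr(($h : V)))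
      · obtain ⟨r, hr⟩ := Submodule.mem_span_singleton.1 w.2
        change e • (w : V) ∈ F
        rw [← hr]
        exact heF r
  · rw [eq_top_iff]
    exact fun v _ => Submodule.mem_iSup_of_mem v (Submodule.mem_span_singleton_self v)

/-- Schur's lemma: if some ring element acts on a simple module with nonzero finite rank, all
endomorphisms are scalars. -/
theorem exists_eq_smul_of_finiteRank [IsSimpleModule R V] (e : R) (F : Submodule ℂ V)
    [FiniteDimensional ℂ F] (heF : ∀ v : V, e • v ∈ F) (v₀ : V) (hv₀ : e • v₀ ≠ 0)
    (f : Module.End R V) : ∃ z : ℂ, ∀ v, f v = z • v := by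
  let E : Submodule ℂ V := LinearMap.range (Algebra.lsmul ℂ ℂ V e)
  have hE : E ≤ F := by
    rintro _ ⟨v, rfl⟩
    exact heF v
  have : FiniteDimensional ℂ E := Submodule.finiteDimensional_of_le hE
  have : Nontrivial E := ⟨⟨⟨e • v₀, v₀, rfl⟩, 0, fun h => hv₀ congr(($h : V))⟩⟩
  -- Since `f` commutes with `e`, it preserves the finite-dimensional `e V` and has an eigenvalue
  -- `z` there. Then `f - z` is not injective, so it vanishes.
  let fE : Module.End ℂ E := (f.restrictScalars ℂ).restrict (p := E) (q := E) (by
    rintro _ ⟨v, rfl⟩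
    exact ⟨f v, (f.map_smul e v).symm⟩)
  obtain ⟨z, hz⟩ := Module.End.exists_eigenvalue fE
  obtain ⟨x, hx⟩ := hz.exists_hasEigenvector
  refine ⟨z, ?_⟩
  have hx1 : f x = z • (x : V) := congr(($(hx.apply_eq_smul) : V))
  let g : Module.End R V :=
    { toFun v := f v - z • v
      map_add' u v := by rw [map_add, smul_add]; abel
      map_smul' r v := by
        rw [RingHom.id_apply, map_smul, smul_sub, smul_comm z r v] }
  rcases LinearMap.injective_or_eq_zero g with hg | hg
  · refine absurd (hg (a₁ := (x : V)) (a₂ := 0) ?_) fun h => hx.2 (Subtype.ext h)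
    rw [map_zero]
    exact sub_eq_zero.2 hx1
  · exact fun v => sub_eq_zero.1 congr($hg v)

/-- The density theorem for simple modules all of whose endomorphisms are scalars. -/
theorem exists_smul_eq_of_scalar_endomorphisms {R V : Type*} [Ring R] [AddCommGroup V]
    [Module ℂ V] [Module R V] [IsSimpleModule R V]
    (hf : ∀ f : Module.End R V, ∃ z : ℂ, ∀ v, f v = z • v) (T : V →ₗ[ℂ] V) (s : Finset V) :
    ∃ r : R, ∀ m ∈ s, T m = r • m := by
  let T' : Module.End (Module.End R V) V :=
    { toFun := T
      map_add' := T.map_add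
      map_smul' f v := by
        obtain ⟨z, hz⟩ := hf f
        rw [Module.End.smul_def, Module.End.smul_def, hz, map_smul, RingHom.id_apply, hz] }
  exact jacobson_density T' s

end Semisimple

/-! ### Equivariant modules as modules over a free algebra. -/

section OperatorModule

variable {k : Type*} [Field k] {X : Type*}
variable {V : Type*} [AddCommGroup V] [Module k V] {W : Type*} [AddCommGroup W] [Module k W]

/-- A vector space with a family of operators, as a module over the free algebra. -/
def OperatorModule (_T : X → Module.End k V) : Type _ := V

namespace OperatorModule

variable {T : X → Module.End k V} {U : X → Module.End k W}

instance : AddCommGroup (OperatorModule T) := inferInstanceAs (AddCommGroup V)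

instance : Module k (OperatorModule T) := inferInstanceAs (Module k V)

noncomputable instance : Module (FreeAlgebra k X) (OperatorModule T) :=
  Module.compHom V (FreeAlgebra.lift k T).toRingHom

theorem smul_def (r : FreeAlgebra k X) (v : OperatorModule T) :
    r • v = (FreeAlgebra.lift k T r : Module.End k V) v := rfl

theorem ι_smul (x : X) (v : OperatorModule T) :
    FreeAlgebra.ι k x • v = (T x (v : V) : V) := by
  rw [smul_def, FreeAlgebra.lift_ι_apply]

instance : IsScalarTower k (FreeAlgebra k X) (OperatorModule T) where
  smul_assoc c r v := by rw [smul_def, map_smul]; rfl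

theorem map_lift (f : V →ₗ[k] W) (hf : ∀ x v, f (T x v) = U x (f v)) (r : FreeAlgebra k X)
    (v : V) : f (FreeAlgebra.lift k T r v) = FreeAlgebra.lift k U r (f v) := by
  induction r generalizing v with
  | grade0 c => simp
  | grade1 x => simp [hf]
  | mul a b ha hb => simp_all
  | add a b ha hb => simp_all

theorem lift_mem (N : Submodule k V) (hN : ∀ x, ∀ v ∈ N, T x v ∈ N) (r : FreeAlgebra k X)
    {v : V} (hv : v ∈ N) : FreeAlgebra.lift k T r v ∈ N := by
  induction r generalizing v with
  | grade0 c => simpa using N.smul_mem c hv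
  | grade1 x => simpa using hN x v hv
  | mul a b ha hb => simpa using ha (hb hv)
  | add a b ha hb => simpa using N.add_mem (ha hv) (hb hv)

/-- A linear map that commutes with the operators, as a map of operator modules. -/
noncomputable def map (f : V →ₗ[k] W) (hf : ∀ x v, f (T x v) = U x (f v)) :
    OperatorModule T →ₗ[FreeAlgebra k X] OperatorModule U where
  toFun v := f v
  map_add' := f.map_add
  map_smul' := map_lift f hf

end OperatorModule
end OperatorModule

section Operators

variable {k : Type*} [Field k] {H : Type*} [Ring H] [HopfAlgebra k H]
variable {A : Type*} [Ring A] [Algebra k A] {V : Type*} [AddCommGroup V] [Module k V]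

/-- The operators of an equivariant module: the action of `A` and of the functionals on `H`. -/
noncomputable def equivariantOp (ρ : A →ₐ[k] Module.End k V) (δ : V →ₗ[k] V ⊗[k] H) :
    A ⊕ (H →ₗ[k] k) → Module.End k V :=
  Sum.elim (fun a => ρ a) fun f => slice V f ∘ₗ δ

/-- The operators of the cofree equivariant module `V ⊗ H` on an `A`-module `V`. -/
noncomputable def cofreeOp (α : A →ₐ[k] A ⊗[k] H) (ρ : A →ₐ[k] Module.End k V) :
    A ⊕ (H →ₗ[k] k) → Module.End k (V ⊗[k] H) :=
  Sum.elim (fun a => tensorAction H ρ (α a)) fun f => (convOp f).lTensor V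

theorem tensorAction_lmul (x y : A ⊗[k] H) :
    tensorAction H (Algebra.lmul k A) x y = x * y := by
  induction x with
  | zero => simp
  | add u v hu hv => rw [map_add, LinearMap.add_apply, hu, hv, add_mul]
  | tmul a h =>
    induction y with
    | zero => simp
    | add u v hu hv => rw [map_add, hu, hv, mul_add]
    | tmul b g => simp [tensorAction]

theorem convOp_lTensor_mul (f : H →ₗ[k] k) (t : A ⊗[k] H) (u : H) :
    (convOp f).lTensor A (t * (1 ⊗ₜ u)) = (slice H f).lTensor A
      ((Coalgebra.comul (R := k)).lTensor A t * (1 ⊗ₜ Coalgebra.comul (R := k) u)) := by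
  induction t with
  | zero => simp
  | tmul a h => simp [convOp]
  | add x y hx hy => simp only [add_mul, map_add, hx, hy]

/-- With `convOp_lTensor_mul`, this shows that functionals preserve sums of spaces `α(A)(1 ⊗ u)`
when `u` runs over a right coideal. -/
theorem slice_lTensor_comul_mul (f : H →ₗ[k] k) (t : A ⊗[k] H) (l r : H) :
    (slice H f).lTensor A ((Coalgebra.comul (R := k)).lTensor A t * (1 ⊗ₜ (l ⊗ₜ r))) =
      (convOp (f ∘ₗ LinearMap.mulRight k r)).lTensor A t * (1 ⊗ₜ l) := by
  induction t with
  | zero => simp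
  | tmul a h =>
    simp only [LinearMap.lTensor_tmul, Algebra.TensorProduct.tmul_mul_tmul, mul_one, convOp,
      LinearMap.comp_apply]
    congr 1
    generalize Coalgebra.comul (R := k) h = s
    induction s with
    | zero => simp
    | tmul x y => simp
    | add x y hx hy => simp only [add_mul, map_add, hx, hy]
  | add x y hx hy => simp only [add_mul, map_add, hx, hy]

/-- Every element of `H` lies in a finite-dimensional right coideal. -/
theorem exists_finite_coideal (h : H) : ∃ U : Submodule k H, FiniteDimensional k U ∧ h ∈ U ∧
    ∀ u ∈ U, Coalgebra.comul (R := k) u ∈ LinearMap.range (U.subtype.rTensor H) := by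
  let r := ℛ k h
  let L : (H →ₗ[k] k) →ₗ[k] H :=
    { toFun f := convOp f h
      map_add' f g := by simp [convOp_apply _ r, add_smul, Finset.sum_add_distrib]
      map_smul' c f := by simp [convOp_apply _ r, mul_smul, Finset.smul_sum] }
  refine ⟨LinearMap.range L, ?_, ⟨Coalgebra.counit, isComodule_comul.slice_counit h⟩, ?_⟩
  · have : FiniteDimensional k (Submodule.span k (r.left '' r.index)) :=
      FiniteDimensional.span_of_finite k (r.index.finite_toSet.image _)
    refine Submodule.finiteDimensional_of_le (S₂ := Submodule.span k (r.left '' r.index)) ?_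
    rintro _ ⟨f, rfl⟩
    change convOp f h ∈ _
    rw [convOp_apply _ r]
    exact sum_mem fun i hi => Submodule.smul_mem _ _ (Submodule.subset_span ⟨i, hi, rfl⟩)
  · rintro _ ⟨g, rfl⟩
    refine mem_range_rTensor_of_slice_mem fun f => ⟨f ∘ₗ convOp g, ?_⟩
    change slice H (f ∘ₗ convOp g) (Coalgebra.comul h) =
      slice H f (Coalgebra.comul (slice H g (Coalgebra.comul h)))
    rw [isComodule_comul.coaction_slice, slice_lTensor]

end Operators

/-! ### Adjoints and finite-rank operators on `A ⊗ H`. -/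

namespace IsPositiveCoaction

variable {H : Type uH} [Ring H] [HopfAlgebra ℂ H] [StarRing H] [StarModule ℂ H]
    {A : Type uA} [Ring A] [Algebra ℂ A] [StarRing A] [StarModule ℂ A]
    {φ : H →ₗ[ℂ] ℂ} {φA : A →ₗ[ℂ] ℂ} {α : A →ₐ[ℂ] A ⊗[ℂ] H}

theorem tensorFunctional_convOp (P : IsPositiveCoaction φ φA α) (f : H →ₗ[ℂ] ℂ)
    (x y : A ⊗[ℂ] H) : tensorFunctional φA φ (star ((convOp f).lTensor A x) * y) =
      tensorFunctional φA φ (star x * (convOp (dualStar f)).lTensor A y) := by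
  have key (g h : H) : φ (star (convOp f g) * h) = φ (star g * convOp (dualStar f) h) := by
    rw [← conj_apply_star_mul P.nonneg h, ← P.integral.apply_star_convOp_mul P.comul_star,
      conj_apply_star_mul P.nonneg]
  induction x with
  | zero => simp
  | add u v hu hv => simp only [map_add, star_add, add_mul, hu, hv]
  | tmul a g =>
    induction y with
    | zero => simp
    | add u v hu hv => simp only [map_add, mul_add, hu, hv]
    | tmul b h => simp [tensorFunctional, key]

theorem exists_adjoint (P : IsPositiveCoaction φ φA α)
    (r : FreeAlgebra ℂ (A ⊕ (H →ₗ[ℂ] ℂ))) : ∃ r' : FreeAlgebra ℂ (A ⊕ (H →ₗ[ℂ] ℂ)),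
      ∀ x y : A ⊗[ℂ] H, tensorFunctional φA φ
        (star (FreeAlgebra.lift ℂ (cofreeOp α (Algebra.lmul ℂ A)) r x) * y) =
        tensorFunctional φA φ (star x * FreeAlgebra.lift ℂ (cofreeOp α (Algebra.lmul ℂ A)) r' y) := by
  induction r with
  | grade0 c => exact ⟨algebraMap ℂ _ (conj c), fun x y => by simp⟩
  | grade1 X =>
    rcases X with a | f
    · refine ⟨FreeAlgebra.ι ℂ (.inl (star a)), fun x y => ?_⟩
      simp only [FreeAlgebra.lift_ι_apply, cofreeOp, Sum.elim_inl, tensorAction_lmul,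
        P.coaction_star, star_mul, mul_assoc]
    · refine ⟨FreeAlgebra.ι ℂ (.inr (dualStar f)), fun x y => ?_⟩
      simp only [FreeAlgebra.lift_ι_apply]
      exact P.tensorFunctional_convOp f x y
  | mul a b ha hb =>
    obtain ⟨a', ha'⟩ := ha
    obtain ⟨b', hb'⟩ := hb
    exact ⟨b' * a', fun x y => by simp only [map_mul, Module.End.mul_apply, ha', hb']⟩
  | add a b ha hb =>
    obtain ⟨a', ha'⟩ := ha
    obtain ⟨b', hb'⟩ := hb
    exact ⟨a' + b', fun x y => by
      simp only [map_add, LinearMap.add_apply, star_add, add_mul, mul_add, ha', hb']⟩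

/-- The maps `a ↦ (id ⊗ φ(t · u)) α(a)` have finite rank. -/
theorem finiteDimensional_range_slice (P : IsPositiveCoaction φ φA α) (t u : H) :
    FiniteDimensional ℂ (LinearMap.range
      (slice A (φ ∘ₗ LinearMap.mulLeft ℂ t ∘ₗ LinearMap.mulRight ℂ u) ∘ₗ α.toLinearMap)) := by
  obtain ⟨C, hC, hr⟩ := P.integral.exists_range_convOp_le P.comul_star t u
  refine P.finiteDimensional_of_coaction_mem _ C ?_
  rintro _ ⟨a, rfl⟩
  have := P.comodule.coaction_slice
    (φ ∘ₗ LinearMap.mulLeft ℂ t ∘ₗ LinearMap.mulRight ℂ u) a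
  simp only [AlgHom.toLinearMap_apply] at this
  simp only [LinearMap.comp_apply, AlgHom.toLinearMap_apply] at this ⊢
  rw [this]
  exact lTensor_mem_range_of_range_le hr _

theorem finiteDimensional_range_convOp (P : IsPositiveCoaction φ φA α) (b u : H) :
    FiniteDimensional ℂ (LinearMap.range ((convOp (φ ∘ₗ LinearMap.mulLeft ℂ b)).lTensor A ∘ₗ
      LinearMap.mulRight ℂ ((1 : A) ⊗ₜ[ℂ] u) ∘ₗ α.toLinearMap)) := by
  let r := ℛ ℂ b
  let q (i) : A →ₗ[ℂ] A :=
    slice A (φ ∘ₗ LinearMap.mulLeft ℂ (r.right i) ∘ₗ LinearMap.mulRight ℂ u) ∘ₗ α.toLinearMap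
  let G (i) : Submodule ℂ (A ⊗[ℂ] H) := (LinearMap.range (q i)).map
    ((TensorProduct.mk ℂ A H).flip (HopfAlgebra.antipode ℂ (r.left i)))
  have hG (i) : FiniteDimensional ℂ (G i) :=
    have := P.finiteDimensional_range_slice (r.right i) u
    inferInstance
  have : FiniteDimensional ℂ (r.index.sup G : Submodule ℂ (A ⊗[ℂ] H)) :=
    Submodule.finiteDimensional_finset_sup r.index G
  refine Submodule.finiteDimensional_of_le (S₂ := r.index.sup G) ?_
  rintro _ ⟨a, rfl⟩
  -- By `h₁ φ(b h₂) = S(b₁) φ(b₂ h)` the operator is a finite sum of slices, each of finite rank on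
  -- `α(A)(1 ⊗ u)`.
  have key (t : A ⊗[ℂ] H) : (convOp (φ ∘ₗ LinearMap.mulLeft ℂ b)).lTensor A t =
      ∑ i ∈ r.index, slice A (φ ∘ₗ LinearMap.mulLeft ℂ (r.right i)) t ⊗ₜ
        HopfAlgebra.antipode ℂ (r.left i) := by
    induction t with
    | zero => simp
    | tmul x h =>
      rw [LinearMap.lTensor_tmul, P.integral.convOp_mulLeft, convOp_apply _ r, map_sum, tmul_sum]
      simp [smul_tmul']
    | add x y hx hy => simp only [map_add, hx, hy, add_tmul, Finset.sum_add_distrib]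
  rw [LinearMap.comp_apply, key]
  refine sum_mem fun i hi => Finset.le_sup (f := G) hi ⟨q i a, ⟨a, rfl⟩, ?_⟩
  simp [q, slice_mul_one_tmul]
  rfl

/-- Every tensor is fixed by one of the operators `id ⊗ φ(b · )`. -/
theorem exists_convOp_lTensor_eq (P : IsPositiveCoaction φ φA α) (v : A ⊗[ℂ] H) :
    ∃ b : H, (convOp (φ ∘ₗ LinearMap.mulLeft ℂ b)).lTensor A v = v := by
  have hslice (f : H →ₗ[ℂ] ℂ) : (convOp f).lTensor A v = slice (A ⊗[ℂ] H) f
      ((TensorProduct.assoc ℂ A H H).symm ((Coalgebra.comul (R := ℂ)).lTensor A v)) := by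
    rw [← lTensor_slice_assoc, LinearEquiv.apply_symm_apply, convOp, LinearMap.lTensor_comp]
    rfl
  obtain ⟨D, hD, hv⟩ := exists_finite_right_leg
    ((TensorProduct.assoc ℂ A H H).symm ((Coalgebra.comul (R := ℂ)).lTensor A v))
  -- The last leg of `(id ⊗ Δ) v` lies in `D`, and there `φ(b ·)` can be made equal to the counit.
  obtain ⟨b, hb⟩ := exists_eq_on_of_separating ((LinearMap.mul ℂ H).compr₂ φ)
    (fun x hx => P.integral.faithful P.nonneg x (hx (star x))) D Coalgebra.counit
  refine ⟨b, ?_⟩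
  rw [hslice, slice_congr (f := φ ∘ₗ LinearMap.mulLeft ℂ b) (g := Coalgebra.counit)
    (fun x hx => hb x hx) hv, ← hslice]
  have : convOp (Coalgebra.counit (R := ℂ) (A := H)) = LinearMap.id :=
    LinearMap.ext isComodule_comul.slice_counit
  rw [this, LinearMap.lTensor_id, LinearMap.id_apply]

/-- For `m = 1 ⊗ h` the orbit stays in a finite sum of spaces `α(A)(1 ⊗ u)`, with `u` from a
finite-dimensional coideal containing `h`. In general `a ⊗ h = α(a₀)(1 ⊗ S(a₁) h)` reduces to this
case. -/
theorem exists_finite_orbit (P : IsPositiveCoaction φ φA α) (b : H) (m : A ⊗[ℂ] H) :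
    ∃ F : Submodule ℂ (A ⊗[ℂ] H), FiniteDimensional ℂ F ∧
      ∀ r : FreeAlgebra ℂ (A ⊕ (H →ₗ[ℂ] ℂ)), (convOp (φ ∘ₗ LinearMap.mulLeft ℂ b)).lTensor A
        (FreeAlgebra.lift ℂ (cofreeOp α (Algebra.lmul ℂ A)) r m) ∈ F := by
  let IsFin (m : A ⊗[ℂ] H) : Prop := ∃ F : Submodule ℂ (A ⊗[ℂ] H), FiniteDimensional ℂ F ∧
    ∀ r : FreeAlgebra ℂ (A ⊕ (H →ₗ[ℂ] ℂ)), (convOp (φ ∘ₗ LinearMap.mulLeft ℂ b)).lTensor A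
      (FreeAlgebra.lift ℂ (cofreeOp α (Algebra.lmul ℂ A)) r m) ∈ F
  have one_tmul (h : H) : IsFin (1 ⊗ₜ h) := by
    obtain ⟨U, hU, hhU, hcU⟩ := exists_finite_coideal (k := ℂ) h
    obtain ⟨s, hs⟩ := Module.Finite.iff_fg.1 hU
    let N : Submodule ℂ (A ⊗[ℂ] H) := s.sup fun u =>
      LinearMap.range (LinearMap.mulRight ℂ ((1 : A) ⊗ₜ[ℂ] u) ∘ₗ α.toLinearMap)
    have hN (a : A) (u : H) (hu : u ∈ U) : α a * (1 ⊗ₜ u) ∈ N := by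
      rw [← hs] at hu
      induction hu using Submodule.span_induction with
      | mem u hu => exact Finset.le_sup (f := fun u => LinearMap.range
          (LinearMap.mulRight ℂ ((1 : A) ⊗ₜ[ℂ] u) ∘ₗ α.toLinearMap)) hu ⟨a, rfl⟩
      | zero => simp
      | add x y _ _ hx hy => rw [tmul_add, mul_add]; exact N.add_mem hx hy
      | smul c x _ hx => rw [tmul_smul, mul_smul_comm]; exact N.smul_mem c hx
    have hNs (T : A ⊗[ℂ] H →ₗ[ℂ] A ⊗[ℂ] H) (F : Submodule ℂ (A ⊗[ℂ] H))
        (hT : ∀ a, ∀ u ∈ s, T (α a * (1 ⊗ₜ u)) ∈ F) : ∀ x ∈ N, T x ∈ F := by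
      change N ≤ F.comap T
      refine Finset.sup_le fun u hu => ?_
      rintro _ ⟨a, rfl⟩
      exact hT a u hu
    let F : Submodule ℂ (A ⊗[ℂ] H) := s.sup fun u =>
      LinearMap.range ((convOp (φ ∘ₗ LinearMap.mulLeft ℂ b)).lTensor A ∘ₗ
        LinearMap.mulRight ℂ ((1 : A) ⊗ₜ[ℂ] u) ∘ₗ α.toLinearMap)
    have hF (u : H) := P.finiteDimensional_range_convOp b u
    refine ⟨F, Submodule.finiteDimensional_finset_sup s _, fun r => ?_⟩
    refine hNs _ F (fun a u hu => Finset.le_sup (f := fun u => LinearMap.range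
      ((convOp (φ ∘ₗ LinearMap.mulLeft ℂ b)).lTensor A ∘ₗ
        LinearMap.mulRight ℂ ((1 : A) ⊗ₜ[ℂ] u) ∘ₗ α.toLinearMap)) hu ⟨a, rfl⟩) _ ?_
    refine OperatorModule.lift_mem N ?_ r (by simpa using hN 1 h hhU)
    have hsU (u : H) (hu : u ∈ s) : u ∈ U := hs ▸ Submodule.subset_span hu
    rintro (a | f)
    · refine hNs _ N fun a' u hu => ?_
      simp only [cofreeOp, Sum.elim_inl, tensorAction_lmul]
      rw [← mul_assoc, ← map_mul]
      exact hN _ u (hsU u hu)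
    · refine hNs _ N fun a' u hu => ?_
      simp only [cofreeOp, Sum.elim_inr]
      rw [convOp_lTensor_mul]
      obtain ⟨t, ht⟩ := hcU u (hsU u hu)
      rw [← ht]
      clear ht
      induction t with
      | zero => simp
      | add x y hx hy => rw [map_add, tmul_add, mul_add, map_add]; exact N.add_mem hx hy
      | tmul l r =>
        rw [LinearMap.rTensor_tmul, slice_lTensor_comul_mul]
        have := P.comodule.coaction_slice (f ∘ₗ LinearMap.mulRight ℂ r) a'
        simp only [AlgHom.toLinearMap_apply] at this
        rw [← this]
        exact hN _ _ l.2
  have add (m n : A ⊗[ℂ] H) : IsFin m → IsFin n → IsFin (m + n) := by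
    rintro ⟨F, hF, hm⟩ ⟨G, hG, hn⟩
    refine ⟨F ⊔ G, inferInstance, fun r => ?_⟩
    rw [map_add, map_add]
    exact Submodule.add_mem_sup (hm r) (hn r)
  have zero : IsFin 0 := ⟨⊥, inferInstance, fun r => by simp⟩
  change IsFin m
  induction m with
  | zero => simpa using zero
  | add m n hm hn => exact add m n hm hn
  | tmul a h =>
    -- `K(x ⊗ y) = x S(y) h`, so `K ∘ Δ = ε(·) h`; coassociativity then recovers `a ⊗ h` from `a₀ ⊗
    -- a₁`.
    let K : H ⊗[ℂ] H →ₗ[ℂ] H :=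
      LinearMap.mulRight ℂ h ∘ₗ LinearMap.mul' ℂ H ∘ₗ (HopfAlgebra.antipode ℂ).lTensor H
    have hK : a ⊗ₜ h = K.lTensor A (TensorProduct.assoc ℂ A H H
        (α.toLinearMap.rTensor H (α.toLinearMap a))) := by
      have hKΔ : K ∘ₗ Coalgebra.comul = (Coalgebra.counit (R := ℂ) (A := H)).smulRight h := by
        ext x
        simp [K, Algebra.algebraMap_eq_smul_one]
      rw [P.comodule.coassoc, ← LinearMap.comp_apply, ← LinearMap.lTensor_comp, hKΔ]
      nth_rw 1 [← P.comodule.slice_counit a]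
      generalize α.toLinearMap a = t
      induction t with
      | zero => simp
      | tmul x c => simp [smul_tmul]
      | add x y hx hy => simp only [map_add, add_tmul, hx, hy]
    rw [hK]
    generalize α.toLinearMap a = t
    induction t with
    | zero => simpa using zero
    | add m n hm hn => simpa only [map_add] using add _ _ hm hn
    | tmul a' c =>
      have : K.lTensor A (TensorProduct.assoc ℂ A H H (α.toLinearMap.rTensor H (a' ⊗ₜ c))) =
          α a' * (1 ⊗ₜ (HopfAlgebra.antipode ℂ c * h)) := by
        rw [LinearMap.rTensor_tmul, AlgHom.toLinearMap_apply]
        generalize α a' = x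
        induction x with
        | zero => simp
        | tmul x d => simp [K, mul_assoc]
        | add x y hx hy => simp only [map_add, add_tmul, add_mul, hx, hy]
      rw [this]
      obtain ⟨F, hF, hr⟩ := one_tmul (HopfAlgebra.antipode ℂ c * h)
      refine ⟨F, hF, fun r => ?_⟩
      have := hr (r * FreeAlgebra.ι ℂ (.inl a'))
      rwa [map_mul, Module.End.mul_apply, FreeAlgebra.lift_ι_apply, cofreeOp, Sum.elim_inl,
        tensorAction_lmul] at this

end IsPositiveCoaction

/-! ### Extension of scalars, and the embedding into cofree modules. -/

section AbsolutelySimple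

variable {k : Type uk} [Field k] {H : Type uH} [Ring H] [HopfAlgebra k H]
variable {A : Type uA} [Ring A] [Algebra k A]
variable {V : Type uV} [AddCommGroup V] [Module k V]

theorem actionBaseChange_one_tmul (K : Type w) [Field K] [Algebra k K]
    (ρ : A →ₐ[k] Module.End k V) (a : A) (x : K ⊗[k] V) :
    actionBaseChange K ρ (1 ⊗ₜ a) x = (ρ a).baseChange K x := by
  induction x with
  | zero => simp
  | tmul c v => rw [actionBaseChange_tmul, one_mul, LinearMap.baseChange_tmul]
  | add x y hx hy => rw [map_add, map_add, hx, hy]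

/-- This makes every subcomodule of `K ⊗ V` stable under the base changes of the operators given by
functionals on `H`. -/
theorem slice_coactionBaseChange (K : Type w) [Field K] [Algebra k K] (δ : V →ₗ[k] V ⊗[k] H)
    (f : H →ₗ[k] k) (x : K ⊗[k] V) :
    slice (K ⊗[k] V) ((TensorProduct.AlgebraTensorModule.rid k K K).toLinearMap ∘ₗ f.baseChange K)
      (coactionBaseChange K δ x) = (slice V f ∘ₗ δ).baseChange K x := by
  induction x with
  | zero => simp
  | add x y hx hy => rw [map_add, map_add, map_add, hx, hy]
  | tmul c v =>
    rw [coactionBaseChange_tmul K δ c v _ rfl, LinearMap.baseChange_tmul, LinearMap.comp_apply]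
    generalize δ v = t
    induction t with
    | zero => simp
    | add x y hx hy => rw [tmul_add, map_add, map_add, map_add, tmul_add, hx, hy]
    | tmul v h => simp [TensorProduct.AlgebraTensorModule.distribBaseChange]

/-- An equivariant module on which the operators are dense is equivariantly absolutely simple. -/
theorem isEquivariantlyAbsolutelySimple_of_density [Nontrivial V] (ρ : A →ₐ[k] Module.End k V)
    (δ : V →ₗ[k] V ⊗[k] H)
    (hd : ∀ (T : V →ₗ[k] V) (s : Finset V), ∃ r : FreeAlgebra k (A ⊕ (H →ₗ[k] k)),
      ∀ m ∈ s, T m = FreeAlgebra.lift k (equivariantOp ρ δ) r m) :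
    IsEquivariantlyAbsolutelySimple.{uk, uH, uA, uV, w} ρ δ := by
  intro K _ _
  refine ⟨?_, fun X hX => or_iff_not_imp_left.2 fun hX0 => ?_⟩
  · obtain ⟨v, hv⟩ := exists_ne (0 : V)
    refine ⟨1 ⊗ₜ 1, 1 ⊗ₜ v, ?_⟩
    rw [actionBaseChange_tmul, one_mul, map_one, Module.End.one_apply]
    exact fun h => hv (Module.Flat.tensorProduct_mk_injective (R := k) (S := K) (M := V) 
      (h.trans (tmul_zero V 1).symm))
  · have hop (r : FreeAlgebra k (A ⊕ (H →ₗ[k] k))) :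
        ∀ x ∈ X, (FreeAlgebra.lift k (equivariantOp ρ δ) r).baseChange K x ∈ X := by
      induction r with
      | grade0 c =>
        intro x hx
        convert! X.smul_mem (algebraMap k K c) hx using 1
        rw [AlgHom.commutes, Algebra.algebraMap_eq_smul_one, LinearMap.baseChange_smul]
        simp
      | grade1 y =>
        intro x hx
        rw [FreeAlgebra.lift_ι_apply]
        rcases y with a | f
        · change (ρ a).baseChange K x ∈ X
          rw [← actionBaseChange_one_tmul]
          exact hX.action_mem _ x hx
        · change (slice V f ∘ₗ δ).baseChange K x ∈ X
          rw [← slice_coactionBaseChange]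
          exact slice_mem_of_mem_range_rTensor _ (hX.coaction_mem x hx)
      | mul a b ha hb =>
        intro x hx
        rw [map_mul, Module.End.mul_eq_comp, LinearMap.baseChange_comp]
        exact ha _ (hb x hx)
      | add a b ha hb =>
        intro x hx
        rw [map_add, LinearMap.baseChange_add]
        exact X.add_mem (ha x hx) (hb x hx)
    obtain ⟨x, hxX, hx0⟩ := X.ne_bot_iff.1 hX0
    let b := Module.Free.chooseBasis k V
    obtain ⟨i, hi⟩ : ∃ i, TensorProduct.equivFinsuppOfBasisRight b x i ≠ 0 := by
      by_contra! h
      exact hx0 ((TensorProduct.equivFinsuppOfBasisRight b).map_eq_zero_iff.1 (Finsupp.ext h))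
    have hmem (m : V) : (1 : K) ⊗ₜ m ∈ X := by
      -- The base change of `T` sends `x` to `cᵢ ⊗ m`, where `cᵢ ≠ 0` is the `i`-th coordinate of
      -- `x`. Density realizes `T` on the finite-dimensional `C` carrying the `V`-leg of `x`, and
      -- dividing by `cᵢ` gives `1 ⊗ m`.
      let T : V →ₗ[k] V := (b.coord i).smulRight m
      obtain ⟨C, hC, hxC⟩ := exists_finite_right_leg x
      obtain ⟨s, hs⟩ := Module.Finite.iff_fg.1 hC
      obtain ⟨r, hr⟩ := hd T s
      have hTr : T.baseChange K x = (FreeAlgebra.lift k (equivariantOp ρ δ) r).baseChange K x := by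
        have hC : T ∘ₗ C.subtype = FreeAlgebra.lift k (equivariantOp ρ δ) r ∘ₗ C.subtype := by
          ext y
          have : Set.EqOn T (FreeAlgebra.lift k (equivariantOp ρ δ) r) (Submodule.span k (s : Set V)) :=
            LinearMap.eqOn_span hr
          exact this (hs ▸ y.2)
        obtain ⟨u, rfl⟩ := hxC
        rw [LinearMap.baseChange_eq_ltensor, LinearMap.baseChange_eq_ltensor,
          ← LinearMap.comp_apply, ← LinearMap.lTensor_comp, hC, LinearMap.lTensor_comp]
        rfl
      have hT (x : K ⊗[k] V) :
          T.baseChange K x = TensorProduct.equivFinsuppOfBasisRight b x i ⊗ₜ m := by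
        induction x with
        | zero => simp
        | tmul c v => simp [T, smul_tmul]
        | add x y hx hy => rw [map_add, map_add, hx, hy, Finsupp.add_apply, add_tmul]
      have h1 := X.smul_mem (TensorProduct.equivFinsuppOfBasisRight b x i)⁻¹ (hop r x hxX)
      rwa [← hTr, hT, smul_tmul', smul_eq_mul, inv_mul_cancel₀ hi] at h1
    rw [eq_top_iff]
    rintro y -
    induction y with
    | zero => exact X.zero_mem
    | add y z hy hz => exact X.add_mem hy hz
    | tmul c v => simpa [smul_tmul'] using X.smul_mem c (hmem v)

/-- Stability under all slices forces `δ` to map `N` into `N ⊗ H`, which embeds in `V ⊗ H` by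
flatness. -/
theorem exists_isRestriction (ρ : A →ₐ[k] Module.End k V) (δ : V →ₗ[k] V ⊗[k] H)
    (N : Submodule k V) (hN : ∀ X, ∀ v ∈ N, equivariantOp ρ δ X v ∈ N) :
    ∃ (ρ' : A →ₐ[k] Module.End k N) (δ' : N →ₗ[k] N ⊗[k] H), IsRestriction ρ δ N ρ' δ' := by
  have hinj : Function.Injective (N.subtype.rTensor H) :=
    Module.Flat.rTensor_preserves_injective_linearMap _ N.subtype_injective
  have hA (a : A) : ∀ v ∈ N, ρ a v ∈ N := hN (.inl a)
  let ρ' : A →ₐ[k] Module.End k N := AlgHom.ofLinearMap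
    { toFun a := (ρ a).restrict (hA a)
      map_add' a b := by ext; simp
      map_smul' c a := by ext; simp } (by ext; simp) (fun a b => by ext; simp)
  let δ' : N →ₗ[k] N ⊗[k] H := (LinearEquiv.ofInjective _ hinj).symm.toLinearMap ∘ₗ
    (δ ∘ₗ N.subtype).codRestrict (LinearMap.range (N.subtype.rTensor H)) fun v =>
      mem_range_rTensor_of_slice_mem fun f => hN (.inr f) v v.2
  refine ⟨ρ', δ', fun a v => rfl, fun v => ?_⟩
  have := congr(($((LinearEquiv.ofInjective _ hinj).apply_symm_apply
    ((δ ∘ₗ N.subtype).codRestrict (LinearMap.range (N.subtype.rTensor H)) (fun v =>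
      mem_range_rTensor_of_slice_mem fun f => hN (.inr f) v v.2) v)) : V ⊗[k] H))
  exact this

theorem IsRestriction.coe_lift {ρ : A →ₐ[k] Module.End k V} {δ : V →ₗ[k] V ⊗[k] H}
    {N : Submodule k V} {ρ' : A →ₐ[k] Module.End k N} {δ' : N →ₗ[k] N ⊗[k] H}
    (h : IsRestriction ρ δ N ρ' δ') (r : FreeAlgebra k (A ⊕ (H →ₗ[k] k))) (v : N) :
    ((FreeAlgebra.lift k (equivariantOp ρ' δ') r v : N) : V) =
      FreeAlgebra.lift k (equivariantOp ρ δ) r v := by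
  refine OperatorModule.map_lift N.subtype ?_ r v
  rintro (a | f) v
  · exact h.action a v
  · simp only [equivariantOp, Sum.elim_inr, LinearMap.comp_apply]
    rw [map_slice, h.coaction]
    rfl

theorem IsEquivariantModule.coaction_equivariantOp {α : A →ₐ[k] A ⊗[k] H}
    {ρ : A →ₐ[k] Module.End k V} {δ : V →ₗ[k] V ⊗[k] H} (h : IsEquivariantModule α ρ δ)
    (X : A ⊕ (H →ₗ[k] k)) (v : V) : δ (equivariantOp ρ δ X v) = cofreeOp α ρ X (δ v) := by
  rcases X with a | f
  · exact h.compat a v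
  · exact h.comodule.coaction_slice f v

theorem IsEquivariantModule.coaction_injective {α : A →ₐ[k] A ⊗[k] H}
    {ρ : A →ₐ[k] Module.End k V} {δ : V →ₗ[k] V ⊗[k] H} (h : IsEquivariantModule α ρ δ) :
    Function.Injective δ :=
  Function.LeftInverse.injective (g := slice V Coalgebra.counit) h.comodule.slice_counit

/-- The orbit map `a ⊗ h ↦ a v ⊗ h` from `A ⊗ H` to `V ⊗ H`. -/
noncomputable def orbitMap (ρ : A →ₐ[k] Module.End k V) (v : V) : A ⊗[k] H →ₗ[k] V ⊗[k] H :=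
  ((LinearMap.applyₗ v) ∘ₗ ρ.toLinearMap).rTensor H

theorem orbitMap_tmul (ρ : A →ₐ[k] Module.End k V) (v : V) (a : A) (h : H) :
    orbitMap ρ v (a ⊗ₜ[k] h) = ρ a v ⊗ₜ h := rfl

theorem orbitMap_cofreeOp (α : A →ₐ[k] A ⊗[k] H) (ρ : A →ₐ[k] Module.End k V) (v : V)
    (X : A ⊕ (H →ₗ[k] k)) (t : A ⊗[k] H) :
    orbitMap ρ v (cofreeOp α (Algebra.lmul k A) X t) = cofreeOp α ρ X (orbitMap ρ v t) := by
  rcases X with a | f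
  · simp only [cofreeOp, Sum.elim_inl, tensorAction_lmul]
    generalize α a = s
    induction s with
    | zero => simp
    | add x y hx hy => rw [add_mul, map_add, hx, hy, map_add, LinearMap.add_apply]
    | tmul b g =>
      induction t with
      | zero => simp
      | add x y hx hy => rw [mul_add, map_add, hx, hy, map_add, map_add]
      | tmul c h => simp [orbitMap_tmul, tensorAction]
  · simp only [cofreeOp, Sum.elim_inr]
    induction t with
    | zero => simp
    | add x y hx hy => simp only [map_add, hx, hy]
    | tmul c h => simp [orbitMap_tmul]

/-- The orbit map as a map of operator modules. -/
noncomputable def orbitHom (α : A →ₐ[k] A ⊗[k] H) (ρ : A →ₐ[k] Module.End k V) (v : V) :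
    OperatorModule (cofreeOp α (Algebra.lmul k A)) →ₗ[FreeAlgebra k (A ⊕ (H →ₗ[k] k))]
      OperatorModule (cofreeOp α ρ) :=
  OperatorModule.map (orbitMap ρ v) (orbitMap_cofreeOp α ρ v)

theorem iSup_range_orbitHom (α : A →ₐ[k] A ⊗[k] H) (ρ : A →ₐ[k] Module.End k V) :
    ⨆ v, LinearMap.range (orbitHom α ρ v) = ⊤ := by
  rw [eq_top_iff]
  rintro (t : V ⊗[k] H) -
  induction t with
  | zero => exact Submodule.zero_mem _
  | add x y hx hy => exact Submodule.add_mem _ hx hy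
  | tmul v h =>
    refine Submodule.mem_iSup_of_mem v ⟨(1 : A) ⊗ₜ[k] h, ?_⟩
    change orbitMap ρ v ((1 : A) ⊗ₜ[k] h) = _
    simp [orbitMap_tmul]

end AbsolutelySimple

/-! ### Semisimplicity of equivariant modules and scalar endomorphisms. -/

namespace IsPositiveCoaction

variable {H : Type uH} [Ring H] [HopfAlgebra ℂ H] [StarRing H] [StarModule ℂ H]
    {A : Type uA} [Ring A] [Algebra ℂ A] [StarRing A] [StarModule ℂ A]
    {φ : H →ₗ[ℂ] ℂ} {φA : A →ₗ[ℂ] ℂ} {α : A →ₐ[ℂ] A ⊗[ℂ] H}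
    {V : Type uV} [AddCommGroup V] [Module ℂ V] {ρ : A →ₐ[ℂ] Module.End ℂ V}

theorem exists_fixing_finite_orbit (P : IsPositiveCoaction φ φA α)
    (m v : OperatorModule (cofreeOp α (Algebra.lmul ℂ A))) :
    ∃ e : FreeAlgebra ℂ (A ⊕ (H →ₗ[ℂ] ℂ)), e • v = v ∧
      ∃ F : Submodule ℂ (OperatorModule (cofreeOp α (Algebra.lmul ℂ A))),
        FiniteDimensional ℂ F ∧ ∀ r : FreeAlgebra ℂ (A ⊕ (H →ₗ[ℂ] ℂ)), e • r • m ∈ F := by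
  obtain ⟨b, hb⟩ := P.exists_convOp_lTensor_eq v
  obtain ⟨F, hF, hr⟩ := P.exists_finite_orbit b m
  refine ⟨FreeAlgebra.ι ℂ (.inr (φ ∘ₗ LinearMap.mulLeft ℂ b)), ?_, F, hF, fun r => ?_⟩
  · rw [OperatorModule.ι_smul]
    exact hb
  · rw [OperatorModule.ι_smul]
    exact hr r

theorem isSemisimpleModule_cofree_self (P : IsPositiveCoaction φ φA α) :
    IsSemisimpleModule (FreeAlgebra ℂ (A ⊕ (H →ₗ[ℂ] ℂ)))
      (OperatorModule (cofreeOp α (Algebra.lmul ℂ A))) :=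
  let c : InnerProductSpace.Core ℂ (OperatorModule (cofreeOp α (Algebra.lmul ℂ A))) :=
    innerCore (tensorFunctional φA φ) P.tensorFunctional_nonneg P.tensorFunctional_definite
  isSemisimpleModule_of_adjoint_of_cyclic c P.exists_adjoint P.exists_fixing_finite_orbit

theorem isSemisimpleModule_cofree (P : IsPositiveCoaction φ φA α)
    (ρ : A →ₐ[ℂ] Module.End ℂ V) :
    IsSemisimpleModule (FreeAlgebra ℂ (A ⊕ (H →ₗ[ℂ] ℂ))) (OperatorModule (cofreeOp α ρ)) :=
  have := P.isSemisimpleModule_cofree_self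
  isSemisimpleModule_of_isSemisimpleModule_submodule'
    (fun v => IsSemisimpleModule.range (orbitHom α ρ v)) (iSup_range_orbitHom α ρ)

/-- The coaction of an equivariant module as a map of operator modules. -/
noncomputable def coactionHom {δ : V →ₗ[ℂ] V ⊗[ℂ] H} (h : IsEquivariantModule α ρ δ) :
    OperatorModule (equivariantOp ρ δ) →ₗ[FreeAlgebra ℂ (A ⊕ (H →ₗ[ℂ] ℂ))]
      OperatorModule (cofreeOp α ρ) :=
  OperatorModule.map δ h.coaction_equivariantOp

theorem isSemisimpleModule (P : IsPositiveCoaction φ φA α) {δ : V →ₗ[ℂ] V ⊗[ℂ] H}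
    (h : IsEquivariantModule α ρ δ) :
    IsSemisimpleModule (FreeAlgebra ℂ (A ⊕ (H →ₗ[ℂ] ℂ))) (OperatorModule (equivariantOp ρ δ)) :=
  have := P.isSemisimpleModule_cofree ρ
  IsSemisimpleModule.of_injective (coactionHom h) h.coaction_injective

/-- All endomorphisms of a simple submodule of an equivariant module are scalars. -/
theorem exists_eq_smul (P : IsPositiveCoaction φ φA α) {δ : V →ₗ[ℂ] V ⊗[ℂ] H}
    (h : IsEquivariantModule α ρ δ)
    (S : Submodule (FreeAlgebra ℂ (A ⊕ (H →ₗ[ℂ] ℂ))) (OperatorModule (equivariantOp ρ δ)))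
    [IsSimpleModule (FreeAlgebra ℂ (A ⊕ (H →ₗ[ℂ] ℂ))) S]
    (f : Module.End (FreeAlgebra ℂ (A ⊕ (H →ₗ[ℂ] ℂ))) S) : ∃ z : ℂ, ∀ v, f v = z • v := by
  have := P.isSemisimpleModule_cofree ρ
  -- Semisimplicity of `V ⊗ H` splits the embedding of `S`. Some orbit map composed with `π` is then
  -- a nonzero map `g : A ⊗ H → S`, which transports finite rank to `S`.
  obtain ⟨π, hπ⟩ := IsSemisimpleModule.extension_property (coactionHom h ∘ₗ S.subtype)
    (h.coaction_injective.comp S.subtype_injective) LinearMap.id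
  have hπ0 : π ≠ 0 := by
    rintro rfl
    have := IsSimpleModule.nontrivial (FreeAlgebra ℂ (A ⊕ (H →ₗ[ℂ] ℂ))) S
    obtain ⟨s, hs⟩ := exists_ne (0 : S)
    exact hs congr($hπ s).symm
  obtain ⟨v, m, hm⟩ : ∃ v m, (π ∘ₗ orbitHom α ρ v) m ≠ 0 := by
    by_contra! h0
    apply hπ0
    rw [← LinearMap.ker_eq_top, eq_top_iff, ← iSup_range_orbitHom α ρ]
    refine iSup_le fun v => ?_
    rintro _ ⟨m, rfl⟩
    exact h0 v m
  let g := π ∘ₗ orbitHom α ρ v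
  obtain ⟨e, he, F, hF, hr⟩ := P.exists_fixing_finite_orbit m m
  -- As `g m` generates the simple `S`, every `e s` has the form `g(e r m)` and lies in `g(F)`;
  -- moreover `e` fixes `g m ≠ 0`.
  refine exists_eq_smul_of_finiteRank e (F.map (g.restrictScalars ℂ)) (fun s => ?_) (g m) ?_ f
  · obtain ⟨r, rfl⟩ := IsSimpleModule.toSpanSingleton_surjective
      (FreeAlgebra ℂ (A ⊕ (H →ₗ[ℂ] ℂ))) hm s
    refine ⟨e • r • m, hr r, ?_⟩
    simp [g]
  · rwa [← map_smul, he]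

theorem isCoactionAbsolutelySemisimple (P : IsPositiveCoaction φ φA α) :
    IsCoactionAbsolutelySemisimple.{0, uH, uA, uV, w} α := by
  intro V _ _ ρ δ h
  have := P.isSemisimpleModule h
  obtain ⟨s, hind, hsup, hsimple⟩ := IsSemisimpleModule.exists_sSupIndep_sSup_simples_eq_top
    (FreeAlgebra ℂ (A ⊕ (H →ₗ[ℂ] ℂ))) (OperatorModule (equivariantOp ρ δ))
  let W (S : Submodule (FreeAlgebra ℂ (A ⊕ (H →ₗ[ℂ] ℂ))) (OperatorModule (equivariantOp ρ δ))) :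
      Submodule ℂ V := S.restrictScalars ℂ
  refine ⟨s, fun S => W S, ?_, fun S => ?_⟩
  · let _ : DecidableEq s := fun a b => Classical.propDecidable (a = b)
    have := DirectSum.isInternal_submodule_of_iSupIndep_of_iSup_eq_top (A := fun S : s => S.1)
      ((sSupIndep_iff _).1 hind) (by rw [← sSup_eq_iSup', hsup])
    exact this
  · have hS := hsimple S S.2
    have hN (X : A ⊕ (H →ₗ[ℂ] ℂ)) (v : V) (hv : v ∈ W S) : equivariantOp ρ δ X v ∈ W S := by
      exact (congrArg (· ∈ S.1) (OperatorModule.ι_smul X v)).mp (S.1.smul_mem _ hv)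
    obtain ⟨ρ', δ', hres⟩ := exists_isRestriction ρ δ (W S) hN
    refine ⟨ρ', δ', hres, ?_⟩
    have : Nontrivial (W S) :=
      IsSimpleModule.nontrivial (FreeAlgebra ℂ (A ⊕ (H →ₗ[ℂ] ℂ))) S.1
    refine isEquivariantlyAbsolutelySimple_of_density ρ' δ' fun T t => ?_
    obtain ⟨r, hr⟩ := exists_smul_eq_of_scalar_endomorphisms (V := S.1)
      (P.exists_eq_smul h S.1) T t
    refine ⟨r, fun m hm => Subtype.ext ?_⟩
    rw [hres.coe_lift]
    exact congrArg Subtype.val (hr m hm)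

end IsPositiveCoaction

end HopfCoaction

theorem mainTheorem9 {H : Type uH} [Ring H] [HopfAlgebra ℂ H]
    -- `H` is a Hopf `*`-algebra
    [StarRing H] [StarModule ℂ H]
    (hcomul : ∀ h : H, Coalgebra.comul (R := ℂ) (star h) = star (Coalgebra.comul (R := ℂ) h))
    -- `φ` is a positive invariant integral
    (φ : H →ₗ[ℂ] ℂ) (hφ : HopfCoaction.IsInvariantIntegral φ)
    (hφ_pos : ∀ h : H, 0 ≤ φ (star h * h))
    -- `α` is a homogeneous `*`-preserving coaction on the unital `*`-algebra `A`
    {A : Type uA} [Ring A] [Algebra ℂ A] [StarRing A] [StarModule ℂ A]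
    (α : A →ₐ[ℂ] A ⊗[ℂ] H) (hα : HopfCoaction.IsComodule α.toLinearMap)
    (hα_star : ∀ a : A, α (star a) = star (α a))
    (hα_hom : HopfCoaction.IsHomogeneous α)
    -- `φA` is the induced functional: `(id ⊗ φ) α(a) = φA(a) 1`
    (φA : A →ₗ[ℂ] ℂ)
    (hφA : ∀ a : A, TensorProduct.rid ℂ A (φ.lTensor A (α a)) = φA a • (1 : A))
    -- `φA(a* b)` is a (definite) inner product on `A`
    (hφA_pos : ∀ a : A, 0 ≤ φA (star a * a))
    (hφA_def : ∀ a : A, φA (star a * a) = 0 → a = 0) :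
    HopfCoaction.IsCoactionAbsolutelySemisimple.{0, uH, uA, uV, w} α :=
  HopfCoaction.IsPositiveCoaction.isCoactionAbsolutelySemisimple
    ⟨hcomul, hφ, hφ_pos, hα, hα_star, hφA, hφA_pos, hφA_def⟩
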